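/- Let $B=(B_t)_{t\ge 0}$ be a standard real Brownian motion on a probability space $(\Omega,\mathcal F,\mathbb P)$ (with $B_0=0$ and continuous paths almost surely), let $\sigma>0$, and let $X_t=\sigma B_t$; these processes are the symmetric $\alpha$-stable processes with $\alpha=2$. For $\varepsilon>0$ put $$\hat\theta_\varepsilon=\frac{i}{2\pi}\int_0^1\int_0^t\int_{\mathbb R} p\,e^{ip(X_t-X_s)}\,e^{-p^2\varepsilon/2}\,dp\,ds\,dt=\int_0^1\int_0^t\rho_\varepsilon'(X_t-X_s)\,ds\,dt,\qquad \rho_\varepsilon(x)=\frac{1}{\sqrt{2\pi\varepsilon}}e^{-x^2/(2\varepsilon)}.$$ Then, as $\varepsilon\downarrow 0$, $\hat\theta_\varepsilon$ converges almost surely and in $L^p(\mathbb P)$ for every $p\in(0,\infty)$ to a random variable $\hat\theta$, the derivative of self-intersection local time of $X$ over $[0,1]$, formally $\int_0^1\int_0^t\delta'(X_t-X_s)\,ds\,dt=\frac{i}{2\pi}\int_0^1\int_0^t\int_{\mathbb R}p\,e^{ip(X_t-X_s)}\,dp\,ds\,dt$. Moreover, for every $\gamma\in[0,\tfrac12)$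 there exists a constant $M>0$ such that $$\mathbb E\big[\exp\{M|\hat\theta|^\gamma\}\big]<\infty.$$ -/

import Mathlib

open MeasureTheory ProbabilityTheory Filter Topology
open scoped NNReal ENNReal

/-- The regularised derivative of self-intersection local time over `[0, 1]` of a process `X`:
`(i / 2π) ∫₀¹ ∫₀ᵗ ∫_ℝ p e^{ip(X_t - X_s)} e^{-p²ε/2} dp ds dt`.
For `ε > 0` it equals `∫₀¹ ∫₀ᵗ ρ_ε'(X_t - X_s) ds dt`, where `ρ_ε` is the Gaussian density of
variance `ε`; in particular its values are real. -/
noncomputable def dsltApprox {Ω : Type*} (X : ℝ≥0 → Ω → ℝ) (ε : ℝ) (ω : Ω) : ℂ :=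
  Complex.I / (2 * (Real.pi : ℂ)) *
    ∫ t in (0 : ℝ)..1, ∫ s in (0 : ℝ)..t, ∫ p : ℝ,
      (p : ℂ) * Complex.exp (Complex.I * (p : ℂ) *
          ((X t.toNNReal ω - X s.toNNReal ω : ℝ) : ℂ)) *
        Complex.exp (-((p : ℂ) ^ 2 * (ε : ℂ) / 2))

/-- The derivative of self-intersection local time of `X` over `[0, 1]`: the pathwise limit of the
regularisations as `ε ↓ 0` (a junk value at those `ω` for which the limit does not exist). -/
noncomputable def dslt {Ω : Type*} (X : ℝ≥0 → Ω → ℝ) (ω : Ω) : ℂ :=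
  limUnder (𝓝[>] (0 : ℝ)) (fun ε : ℝ => dsltApprox X ε ω)

/-! Cut the triangle `0 < s ≤ t ≤ 1` dyadically into squares touching the diagonal at a corner `(m,
m)`. On such a square `B_t - B_s = (B_t - B_m) + (B_m - B_s)` is a sum of two independent Brownian
motions, both started at time `m`. If `f` has Fourier density `ψ`, the `n`-th moment of the integral
of `f (B_t - B_s)` over a square of side `h` is therefore at most the integral of `∏ ‖ψ (p k)‖`
against `boxKernel h p ^ 2` (`enorm_moment_squareIntegral_le`). Ordering the times and passing to
increments makes the kernel factorise in the tail sums of `p` (`orderedKernel_le`). Weights `|p|^a`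
are then integrable for `a < 3/2`, and `lintegral_weight_boxKernel_le` is the basic estimate.

Weight `|p|`: the moments of one square are at most `n! (C h)^n`, so its moment generating function
is sub-Gaussian near `0`. The squares of one generation are independent and centred, so generation
`k` has size about `2^(-k/2)`, and convexity of `exp` sums the generations
(`integral_exp_triangleIntegral_le`). The frequency density of the heat kernel derivative is bounded
by `|p|` for every `ε`, so the regularisations have exponential moments bounded uniformly in `ε`.

Weight `|p|^(5/4)`: second moments bound the `ε`-derivative of the regularisation in `L¹` by a
multiple of `ε^(-7/8)`, which is integrable at `0`. Hence almost every path `ε ↦ θ_ε` has an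
integrable derivative near `0` and converges (`ae_tendsto_dsltLimit`), and it converges in `L¹` as
well. The exponential moments upgrade this to every `L^p`, and Fatou passes them to the limit. This
gives integrability of `exp (c |θ|)` for some `c > 0`, which covers all exponents up to `1`. -/

/-! ### Characteristic function of Brownian motion at several times, integrated over a box -/

theorem lintegral_pi_prod {n : ℕ} (f : Fin n → ℝ → ℝ≥0∞) (hf : ∀ i, Measurable (f i)) :
    ∫⁻ x : Fin n → ℝ, ∏ i, f i (x i) = ∏ i, ∫⁻ x, f i x := by
  induction n with
  | zero => simp [volume_pi]
  | succ n ih =>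
    have h := (volume_preserving_piFinSuccAbove (fun _ : Fin (n + 1) => ℝ) 0).symm
    rw [← h.lintegral_comp_emb (MeasurableEquiv.measurableEmbedding _), Fin.prod_univ_succ,
      ← ih _ fun i => hf _, ← lintegral_prod_mul (hf 0).aemeasurable
        (Finset.measurable_prod _ fun i _ => (hf i.succ).comp (measurable_pi_apply i)).aemeasurable]
    simp [Fin.prod_univ_succ, MeasurableEquiv.piFinSuccAbove, Fin.insertNthEquiv]
    rfl

/-- The variance of `∑ k, p k * B (t k)` for a standard Brownian motion `B`. -/
noncomputable def brownianForm {n : ℕ} (p t : Fin n → ℝ) : ℝ :=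
  ∑ k, ∑ l, p k * p l * min (t k) (t l)

/-- The index is a natural number so that the empty tail `j = n` is available when consecutive tails
are subtracted. -/
noncomputable def tailSum {n : ℕ} (p : Fin n → ℝ) (j : ℕ) : ℝ :=
  ∑ k : Fin n, if j ≤ k then p k else 0

theorem brownianForm_comp_perm {n : ℕ} (p t : Fin n → ℝ) (σ : Equiv.Perm (Fin n)) :
    brownianForm (p ∘ σ) (t ∘ σ) = brownianForm p t := by
  unfold brownianForm
  rw [← Equiv.sum_comp σ (fun k => ∑ l, p k * p l * min (t k) (t l))]
  refine Finset.sum_congr rfl fun k _ => ?_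
  rw [← Equiv.sum_comp σ (fun l => p (σ k) * p l * min (t (σ k)) (t l))]
  rfl

theorem continuous_brownianForm {n : ℕ} :
    Continuous fun z : (Fin n → ℝ) × (Fin n → ℝ) => brownianForm z.1 z.2 := by
  unfold brownianForm; fun_prop

/-- Partial sums of increments. -/
def headSum {n : ℕ} (τ : Fin n → ℝ) (k : Fin n) : ℝ := ∑ j, if j ≤ k then τ j else 0

theorem headSum_mono {n : ℕ} {τ : Fin n → ℝ} (hτ : ∀ j, 0 ≤ τ j) : Monotone (headSum τ) := by
  intro k l hkl
  refine Finset.sum_le_sum fun j _ => ?_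
  by_cases h : j ≤ k
  · simp [h, h.trans hkl]
  · simp only [h, if_false]; split_ifs <;> simp [hτ]

/-- Summation by parts: the `j`-th Brownian increment enters `∑ k, p k * B (t k)` with coefficient
`tailSum p j`, and increments are independent, so the form becomes diagonal. -/
theorem brownianForm_headSum {n : ℕ} (p τ : Fin n → ℝ) (hτ : ∀ j, 0 ≤ τ j) :
    brownianForm p (headSum τ) = ∑ j : Fin n, τ j * tailSum p j ^ 2 := by
  have key : ∀ k l, min (headSum τ k) (headSum τ l) =
      ∑ j, τ j * ((if j ≤ k then 1 else 0) * (if j ≤ l then 1 else 0)) := by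
    intro k l
    rw [← (headSum_mono hτ).map_min]
    refine Finset.sum_congr rfl fun j _ => ?_
    by_cases h1 : j ≤ k <;> by_cases h2 : j ≤ l <;> simp [h1, h2]
  unfold brownianForm tailSum
  simp_rw [key, Finset.mul_sum]
  calc _ = ∑ k, ∑ j, ∑ l, p k * p l *
        (τ j * ((if j ≤ k then 1 else 0) * (if j ≤ l then 1 else 0))) :=
        Finset.sum_congr rfl fun k _ => Finset.sum_comm
    _ = ∑ j, ∑ k, ∑ l, p k * p l *
        (τ j * ((if j ≤ k then 1 else 0) * (if j ≤ l then 1 else 0))) := Finset.sum_comm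
    _ = _ := by
      refine Finset.sum_congr rfl fun j _ => ?_
      rw [sq, Finset.sum_mul_sum, Finset.mul_sum]
      refine Finset.sum_congr rfl fun k _ => ?_
      rw [Finset.mul_sum]
      refine Finset.sum_congr rfl fun l _ => ?_
      simp only [Fin.val_fin_le]
      split_ifs <;> ring

theorem headSum_succ_sub {n : ℕ} (τ : Fin n → ℝ) (j : Fin n) (hj : 0 < (j : ℕ)) :
    headSum τ j = headSum τ ⟨j - 1, by omega⟩ + τ j := by
  unfold headSum
  have : τ j = ∑ i, if i = j then τ i else 0 := by simp
  rw [this, ← Finset.sum_add_distrib]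
  refine Finset.sum_congr rfl fun i _ => ?_
  simp only [Fin.le_def, Fin.ext_iff]
  split_ifs <;> first | omega | simp

theorem headSum_zero {n : ℕ} (τ : Fin n → ℝ) (j : Fin n) (hj : (j : ℕ) = 0) :
    headSum τ j = τ j := by
  unfold headSum
  have : τ j = ∑ i, if i = j then τ i else 0 := by simp
  rw [this]
  refine Finset.sum_congr rfl fun i _ => ?_
  simp only [Fin.le_def, Fin.ext_iff, hj, Nat.le_zero]

theorem nonneg_of_headSum_mono {n : ℕ} {τ : Fin n → ℝ} (h : Monotone (headSum τ))
    (h0 : ∀ j, 0 ≤ headSum τ j) (j : Fin n) : 0 ≤ τ j := by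
  rcases Nat.eq_zero_or_pos (j : ℕ) with hj | hj
  · rw [← headSum_zero τ j hj]; exact h0 j
  · have := headSum_succ_sub τ j hj
    have h2 : headSum τ ⟨j - 1, by omega⟩ ≤ headSum τ j := h (by simp [Fin.le_def])
    linarith

/-- A sum of nonnegative increments is the last partial sum. -/
theorem sum_le_of_headSum_le {n : ℕ} {τ : Fin n → ℝ} {h : ℝ} (hh : 0 ≤ h)
    (H : ∀ j, headSum τ j ≤ h) : ∑ j, τ j ≤ h := by
  cases n with
  | zero => simpa
  | succ n =>
    convert H (Fin.last n) using 1
    unfold headSum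
    simp [Fin.le_last]

/-- The map is linear with a unit triangular matrix, hence of determinant `1`. -/
theorem measurePreserving_headSum (n : ℕ) :
    MeasurePreserving (headSum : (Fin n → ℝ) → Fin n → ℝ) := by
  let M : Matrix (Fin n) (Fin n) ℝ := .of fun k j => if j ≤ k then 1 else 0
  have hd : M.det = 1 := by
    rw [Matrix.det_of_isLowerTriangular]
    · simp [M]
    · intro i j hij
      simp only [M, Matrix.of_apply]
      rw [if_neg]
      simpa using hij
  have hM : (headSum : (Fin n → ℝ) → Fin n → ℝ) = Matrix.toLin' M := by
    ext τ k
    simp [headSum, M, Matrix.mulVec, dotProduct]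
  refine ⟨?_, ?_⟩
  · rw [hM]; exact (LinearMap.continuous_of_finiteDimensional _).measurable
  · rw [hM, Real.map_matrix_volume_pi_eq_smul_volume_pi (by simp [hd]), hd]; simp

theorem measurePreserving_tailSum (n : ℕ) :
    MeasurePreserving (fun (p : Fin n → ℝ) (j : Fin n) => tailSum p j) := by
  let M : Matrix (Fin n) (Fin n) ℝ := .of fun j k => if j ≤ k then 1 else 0
  have hd : M.det = 1 := by
    rw [Matrix.det_of_isUpperTriangular]
    · simp [M]
    · intro i j hij
      simp only [M, Matrix.of_apply]
      rw [if_neg]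
      simpa using hij
  have hM : (fun (p : Fin n → ℝ) (j : Fin n) => tailSum p j) = Matrix.toLin' M := by
    ext p j
    simp [tailSum, M, Matrix.mulVec, dotProduct]
  refine ⟨?_, ?_⟩
  · rw [hM]; exact (LinearMap.continuous_of_finiteDimensional _).measurable
  · rw [hM, Real.map_matrix_volume_pi_eq_smul_volume_pi (by simp [hd]), hd]; simp

/-- `∫_{[0,h]^n} 𝔼 exp(i ∑ k, p k * B (t k)) dt`. -/
noncomputable def boxKernel {n : ℕ} (h : ℝ) (p : Fin n → ℝ) : ℝ≥0∞ :=
  ∫⁻ t, {t : Fin n → ℝ | ∀ k, t k ∈ Set.Icc 0 h}.indicator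
    (fun t => ENNReal.ofReal (Real.exp (-brownianForm p t / 2))) t

/-- The part of `boxKernel` that comes from ordered times. -/
noncomputable def orderedKernel {n : ℕ} (h : ℝ) (p : Fin n → ℝ) : ℝ≥0∞ :=
  ∫⁻ t, {t : Fin n → ℝ | Monotone t ∧ ∀ k, t k ∈ Set.Icc 0 h}.indicator
    (fun t => ENNReal.ofReal (Real.exp (-brownianForm p t / 2))) t

theorem measurableSet_box {n : ℕ} (h : ℝ) :
    MeasurableSet {t : Fin n → ℝ | ∀ k, t k ∈ Set.Icc 0 h} := by
  have : {t : Fin n → ℝ | ∀ k, t k ∈ Set.Icc 0 h} = Set.univ.pi fun _ => Set.Icc 0 h := by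
    ext; simp only [Set.mem_ofPred_eq, Set.mem_univ_pi]
  rw [this]
  exact MeasurableSet.univ_pi fun _ => measurableSet_Icc

theorem measurableSet_ordered {n : ℕ} (h : ℝ) :
    MeasurableSet {t : Fin n → ℝ | Monotone t ∧ ∀ k, t k ∈ Set.Icc 0 h} := by
  refine MeasurableSet.inter ?_ (measurableSet_box h)
  have : {t : Fin n → ℝ | Monotone t} = ⋂ i, ⋂ j, {t | i ≤ j → t i ≤ t j} := by
    ext t; simp [Monotone]
  change MeasurableSet {t : Fin n → ℝ | Monotone t}
  rw [this]
  refine MeasurableSet.iInter fun i => MeasurableSet.iInter fun j => ?_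
  by_cases hij : i ≤ j
  · simp only [hij, true_imp_iff]
    exact measurableSet_le (measurable_pi_apply i) (measurable_pi_apply j)
  · simp [hij]

theorem measurable_exp_brownianForm {n : ℕ} :
    Measurable fun z : (Fin n → ℝ) × (Fin n → ℝ) =>
      ENNReal.ofReal (Real.exp (-brownianForm z.1 z.2 / 2)) := by
  have := (continuous_brownianForm (n := n)).measurable
  fun_prop

theorem measurable_exp_brownianForm_right {n : ℕ} (p : Fin n → ℝ) :
    Measurable fun t : Fin n → ℝ =>
      ENNReal.ofReal (Real.exp (-brownianForm p t / 2)) := by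
  have : Continuous fun t : Fin n → ℝ => brownianForm p t := by unfold brownianForm; fun_prop
  fun_prop

theorem measurable_orderedKernel {n : ℕ} (h : ℝ) :
    Measurable (orderedKernel h : (Fin n → ℝ) → ℝ≥0∞) := by
  unfold orderedKernel
  refine Measurable.lintegral_prod_right (f := fun p : Fin n → ℝ =>
    {t : Fin n → ℝ | Monotone t ∧ ∀ k, t k ∈ Set.Icc 0 h}.indicator
    (fun t => ENNReal.ofReal (Real.exp (-brownianForm p t / 2)))) ?_
  have : (Function.uncurry fun p : Fin n → ℝ =>
    {t : Fin n → ℝ | Monotone t ∧ ∀ k, t k ∈ Set.Icc 0 h}.indicator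
    (fun t => ENNReal.ofReal (Real.exp (-brownianForm p t / 2)))) =
    (Prod.snd ⁻¹' {t : Fin n → ℝ | Monotone t ∧ ∀ k, t k ∈ Set.Icc 0 h}).indicator
      fun z => ENNReal.ofReal (Real.exp (-brownianForm z.1 z.2 / 2)) := by
    ext z; simp [Function.uncurry, Set.indicator]
  rw [this]
  exact measurable_exp_brownianForm.indicator (measurable_snd (measurableSet_ordered h))

theorem measurePreserving_comp_perm {n : ℕ} (σ : Equiv.Perm (Fin n)) :
    MeasurePreserving (fun t : Fin n → ℝ => t ∘ σ) := by
  have := volume_measurePreserving_piCongrLeft (fun _ : Fin n => ℝ) σ.symm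
  have h : (fun t : Fin n → ℝ => t ∘ σ) =
      MeasurableEquiv.piCongrLeft (fun _ : Fin n => ℝ) σ.symm := by
    ext t j
    have := MeasurableEquiv.piCongrLeft_apply_apply (β := fun _ : Fin n => ℝ) σ.symm t (σ j)
    simpa using this.symm
  rw [h]
  exact this

theorem lintegral_comp_perm {n : ℕ} (σ : Equiv.Perm (Fin n)) {G : (Fin n → ℝ) → ℝ≥0∞}
    (hG : Measurable G) : ∫⁻ t, G (t ∘ σ) = ∫⁻ t, G t :=
  (measurePreserving_comp_perm σ).lintegral_comp hG

/-- Each time vector is monotone after `Tuple.sort`. Vectors with ties are counted several times,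
which does no harm to an upper bound. -/
theorem boxKernel_le_sum {n : ℕ} (h : ℝ) (p : Fin n → ℝ) :
    boxKernel h p ≤ ∑ σ : Equiv.Perm (Fin n), orderedKernel h (p ∘ σ) := by
  have hm : ∀ σ : Equiv.Perm (Fin n), Measurable
      ({t : Fin n → ℝ | Monotone t ∧ ∀ k, t k ∈ Set.Icc 0 h}.indicator
        (fun t => ENNReal.ofReal (Real.exp (-brownianForm (p ∘ σ) t / 2)))) := fun σ =>
    (measurable_exp_brownianForm_right _).indicator (measurableSet_ordered h)
  calc boxKernel h p ≤ ∫⁻ t, ∑ σ : Equiv.Perm (Fin n),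
      {t : Fin n → ℝ | Monotone t ∧ ∀ k, t k ∈ Set.Icc 0 h}.indicator
        (fun t => ENNReal.ofReal (Real.exp (-brownianForm (p ∘ σ) t / 2))) (t ∘ σ) := by
        refine lintegral_mono fun t => ?_
        refine Set.indicator_apply_le' (fun ht => ?_) fun _ => bot_le
        refine le_trans ?_ (Finset.single_le_sum (f := fun σ : Equiv.Perm (Fin n) =>
          {t : Fin n → ℝ | Monotone t ∧ ∀ k, t k ∈ Set.Icc 0 h}.indicator
            (fun t => ENNReal.ofReal (Real.exp (-brownianForm (p ∘ σ) t / 2))) (t ∘ σ))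
          (fun _ _ => bot_le) (Finset.mem_univ (Tuple.sort t)))
        rw [Set.indicator_of_mem, brownianForm_comp_perm]
        exact ⟨Tuple.monotone_sort t, fun k => ht _⟩
    _ = ∑ σ : Equiv.Perm (Fin n), orderedKernel h (p ∘ σ) := by
        rw [lintegral_finsetSum]
        · exact Finset.sum_congr rfl fun σ _ => lintegral_comp_perm σ (hm σ)
        · exact fun σ _ => (hm σ).comp (measurePreserving_comp_perm σ).measurable

theorem lintegral_exp_decay {b : ℝ} (hb : 0 < b) :
    ∫⁻ τ : ℝ, (Set.Ici (0 : ℝ)).indicator (fun τ => ENNReal.ofReal (Real.exp (-(b * τ)))) τ =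
      ENNReal.ofReal b⁻¹ := by
  rw [lintegral_indicator measurableSet_Ici, setLIntegral_congr Ioi_ae_eq_Ici.symm,
    ← ofReal_integral_eq_lintegral_ofReal]
  · have := integral_exp_neg_mul_rpow (p := 1) (b := b) one_pos hb
    simp only [Real.rpow_one] at this
    congr 1
    simpa [Real.rpow_neg_one, Real.Gamma_two, one_add_one_eq_two] using this
  · simpa [IntegrableOn] using exp_neg_integrableOn_Ioi 0 hb
  · exact ae_of_all _ fun _ => (Real.exp_pos _).le

/-- The constraint that the increments sum to at most `h` couples the variables. Bounding its
indicator by `exp (lam * (h - ∑ τ))` decouples them, leaving one exponential integral per increment.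
The parameter `lam` is optimised later. -/
theorem orderedKernel_le {n : ℕ} {h : ℝ} (hh : 0 ≤ h) {lam : ℝ} (hl : 0 < lam) (p : Fin n → ℝ) :
    orderedKernel h p ≤ ENNReal.ofReal (Real.exp (lam * h)) *
      ∏ j : Fin n, ENNReal.ofReal (lam + tailSum p j ^ 2 / 2)⁻¹ := by
  unfold orderedKernel
  have hb : ∀ j : Fin n, 0 < lam + tailSum p j ^ 2 / 2 := fun j => by positivity
  rw [← (measurePreserving_headSum n).lintegral_comp
    ((measurable_exp_brownianForm_right _).indicator (measurableSet_ordered h))]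
  simp_rw [← fun j => lintegral_exp_decay (hb j)]
  have hm : ∀ b : ℝ, Measurable
      ((Set.Ici (0 : ℝ)).indicator (fun τ => ENNReal.ofReal (Real.exp (-(b * τ))))) := fun b =>
    Measurable.indicator (by fun_prop) measurableSet_Ici
  rw [← lintegral_pi_prod _ fun j => hm _, ← lintegral_const_mul]
  swap
  · exact Finset.measurable_prod _ fun j _ => (hm _).comp (measurable_pi_apply j)
  refine lintegral_mono fun τ => ?_
  refine Set.indicator_apply_le' (fun ht => ?_) fun _ => bot_le
  obtain ⟨h1, h2⟩ := ht
  have hτ := nonneg_of_headSum_mono h1 fun j => (h2 j).1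
  have hs := sum_le_of_headSum_le hh fun j => (h2 j).2
  rw [Finset.prod_congr rfl fun j _ => Set.indicator_of_mem (Set.mem_Ici.2 (hτ j)) _,
    ← ENNReal.ofReal_prod_of_nonneg fun _ _ => (Real.exp_pos _).le,
    ← ENNReal.ofReal_mul (Real.exp_pos _).le, ← Real.exp_sum, ← Real.exp_add]
  refine ENNReal.ofReal_le_ofReal (Real.exp_le_exp.2 ?_)
  rw [brownianForm_headSum p τ hτ]
  have : ∑ j : Fin n, -((lam + tailSum p j ^ 2 / 2) * τ j) =
      -lam * ∑ j, τ j - (∑ j, τ j * tailSum p j ^ 2) / 2 := by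
    rw [Finset.mul_sum, Finset.sum_div, ← Finset.sum_sub_distrib]
    exact Finset.sum_congr rfl fun j _ => by ring
  rw [this]
  nlinarith [mul_le_mul_of_nonneg_left hs hl.le]

/-- Cauchy–Schwarz for a sum of `n!` terms. -/
theorem boxKernel_sq_le {n : ℕ} (h : ℝ) (p : Fin n → ℝ) :
    boxKernel h p ^ 2 ≤
      (n.factorial : ℝ≥0∞) * ∑ σ : Equiv.Perm (Fin n), orderedKernel h (p ∘ σ) ^ 2 := by
  refine (pow_le_pow_left' (boxKernel_le_sum h p) 2).trans ?_
  have := ENNReal.rpow_sum_le_const_mul_sum_rpow (s := Finset.univ)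
    (fun σ : Equiv.Perm (Fin n) => orderedKernel h (p ∘ σ)) (p := 2) one_le_two
  norm_num [Fintype.card_perm] at this
  exact_mod_cast this

/-! ### Weighted frequency integrals of the kernels -/

/-- Neighbouring tail sums control the individual frequencies. -/
theorem prod_abs_le {n : ℕ} {lam : ℝ} (hl : 0 < lam) (p : Fin n → ℝ) :
    ∏ k, |p k| ≤ ∏ k : Fin n, ((√lam)⁻¹ * (√lam + |tailSum p k|) ^ 2) := by
  have hs : 0 < √lam := Real.sqrt_pos.2 hl
  have hp : ∀ k : Fin n, p k = tailSum p k - tailSum p (k + 1) := by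
    intro k
    unfold tailSum
    rw [← Finset.sum_sub_distrib]
    have : p k = ∑ i, if i = k then p i else 0 := by simp
    rw [this]
    refine Finset.sum_congr rfl fun i _ => ?_
    simp only [Fin.ext_iff]
    split_ifs <;> first | omega | simp
  have hlast : tailSum p n = 0 := by
    unfold tailSum
    exact Finset.sum_eq_zero fun i _ => if_neg (by omega)
  -- For `x, y ≥ 0` and `s > 0`, `s * (x + y) ≤ (s + x) * (s + y)`. A product, unlike the sum `x +
  -- y`, separates over the tail sums.
  have h1 : ∀ k : Fin n, |p k| ≤
      (√lam)⁻¹ * ((√lam + |tailSum p k|) * (√lam + |tailSum p (k + 1)|)) := by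
    intro k
    have h3 : |p k| ≤ |tailSum p k| + |tailSum p (k + 1)| := by
      rw [hp k]; exact abs_sub _ _
    rw [inv_mul_eq_div, le_div_iff₀ hs]
    nlinarith [abs_nonneg (tailSum p k), abs_nonneg (tailSum p (k + 1)),
      mul_nonneg (abs_nonneg (tailSum p k)) (abs_nonneg (tailSum p (k + 1)))]
  refine (Finset.prod_le_prod (fun _ _ => abs_nonneg _) fun k _ => h1 k).trans ?_
  rw [Finset.prod_mul_distrib, Finset.prod_mul_distrib, Finset.prod_mul_distrib]
  simp_rw [sq]
  rw [Finset.prod_mul_distrib (f := fun i : Fin n => √lam + |tailSum p i|)]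
  have hpos : ∀ j, 0 ≤ √lam + |tailSum p j| := fun j => by positivity
  refine mul_le_mul_of_nonneg_left ?_ (by positivity)
  refine mul_le_mul_of_nonneg_left ?_ (Finset.prod_nonneg fun _ _ => hpos _)
  -- The shifted product trades the factor at `0`, which is at least `√lam`, for the factor at `n`,
  -- which equals `√lam` because that tail is empty.
  rw [Fin.prod_univ_eq_prod_range (fun j => √lam + |tailSum p (j + 1)|) n,
    Fin.prod_univ_eq_prod_range (fun j => √lam + |tailSum p j|) n]
  have e := Finset.prod_range_succ' (fun j => √lam + |tailSum p j|) n
  rw [Finset.prod_range_succ, hlast, abs_zero, add_zero] at e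
  have hA : 0 ≤ ∏ j ∈ Finset.range n, (√lam + |tailSum p (j + 1)|) :=
    Finset.prod_nonneg fun _ _ => hpos _
  nlinarith [mul_nonneg hA (abs_nonneg (tailSum p 0))]

theorem weight_le {n : ℕ} {lam a : ℝ} (hl : 0 < lam) (ha : 0 ≤ a) (p : Fin n → ℝ) :
    (∏ k, |p k| ^ a) * (∏ j : Fin n, (lam + tailSum p j ^ 2 / 2)⁻¹) ^ 2 ≤
      ∏ j : Fin n, (4 ^ a * lam ^ (-a / 2) * (lam + tailSum p j ^ 2 / 2) ^ (a - 2)) := by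
  have hs : 0 < √lam := Real.sqrt_pos.2 hl
  have hb : ∀ j : Fin n, 0 < lam + tailSum p j ^ 2 / 2 := fun j => by positivity
  rw [Real.finsetProd_rpow _ _ fun k _ => abs_nonneg _, ← Finset.prod_pow]
  -- The constant comes from `(√lam + |u|)² ≤ 2 * lam + 2 * u² ≤ 4 * (lam + u² / 2)`.
  have h1 : ∏ k, |p k| ≤
      ∏ j : Fin n, (4 * (√lam)⁻¹ * (lam + tailSum p j ^ 2 / 2)) := by
    refine (prod_abs_le hl p).trans (Finset.prod_le_prod (fun _ _ => by positivity) fun j _ => ?_)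
    rw [mul_comm (4 : ℝ), mul_assoc]
    refine mul_le_mul_of_nonneg_left ?_ (by positivity)
    nlinarith [Real.sq_sqrt hl.le, sq_abs (tailSum p j), sq_nonneg (√lam - |tailSum p j|)]
  refine (mul_le_mul_of_nonneg_right (Real.rpow_le_rpow (Finset.prod_nonneg fun _ _ =>
    abs_nonneg _) h1 ha) (Finset.prod_nonneg fun _ _ => by positivity)).trans (le_of_eq ?_)
  rw [← Real.finsetProd_rpow _ _ fun j _ => by have := hb j; positivity,
    ← Finset.prod_mul_distrib]
  refine Finset.prod_congr rfl fun j _ => ?_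
  rw [Real.mul_rpow (by positivity) (hb j).le, Real.mul_rpow (by positivity) (by positivity),
    Real.rpow_sub (hb j), Real.sqrt_eq_rpow, ← Real.rpow_neg hl.le, ← Real.rpow_mul hl.le]
  norm_num
  rw [div_eq_mul_inv, mul_assoc]
  congr 3
  ring

/-- The constant in the Fourier moment bounds. -/
noncomputable def momentConst (a : ℝ) : ℝ :=
  4 ^ a * √2 * ∫ v : ℝ, (1 + v ^ 2) ^ (a - 2)

/-- The source of the threshold `3/2`: decay of order `2 * (2 - a)` is integrable on the line when
it exceeds `1`. -/
theorem integrable_one_add_sq_rpow {a : ℝ} (ha : a < 3 / 2) :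
    Integrable fun v : ℝ => (1 + v ^ 2) ^ (a - 2) := by
  have := integrable_rpow_neg_one_add_norm_sq (E := ℝ) (μ := volume) (r := 2 * (2 - a))
    (by simp; linarith)
  refine this.congr (ae_of_all _ fun v => ?_)
  simp only [Real.norm_eq_abs, sq_abs]
  congr 1; ring

theorem momentConst_nonneg (a : ℝ) : 0 ≤ momentConst a := by
  unfold momentConst
  have : 0 ≤ ∫ v : ℝ, (1 + v ^ 2) ^ (a - 2) := integral_nonneg fun v => by positivity
  positivity

/-- Substituting `u = √(2 * lam) * v` collects the powers of `lam`: `-a/2 + (a - 2) + 1/2 = (a -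
3)/2`. -/
theorem lintegral_weight {lam a : ℝ} (hl : 0 < lam) (ha : a < 3 / 2) :
    ∫⁻ u : ℝ, ENNReal.ofReal (4 ^ a * lam ^ (-a / 2) * (lam + u ^ 2 / 2) ^ (a - 2)) =
      ENNReal.ofReal (momentConst a * lam ^ ((a - 3) / 2)) := by
  have hc : (√(2 * lam))⁻¹ ≠ 0 := by positivity
  have hfun : ∀ u : ℝ, 4 ^ a * lam ^ (-a / 2) * (lam + u ^ 2 / 2) ^ (a - 2) =
      4 ^ a * lam ^ (-a / 2) * lam ^ (a - 2) *
        (fun v : ℝ => (1 + v ^ 2) ^ (a - 2)) ((√(2 * lam))⁻¹ * u) := by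
    intro u
    have : lam + u ^ 2 / 2 = lam * (1 + ((√(2 * lam))⁻¹ * u) ^ 2) := by
      rw [mul_pow, inv_pow, Real.sq_sqrt (by positivity)]; field_simp
    rw [this, Real.mul_rpow hl.le (by positivity)]; ring
  simp_rw [hfun]
  rw [← ofReal_integral_eq_lintegral_ofReal]
  · congr 1
    rw [integral_const_mul,
      Measure.integral_comp_mul_left (fun v : ℝ => (1 + v ^ 2) ^ (a - 2))]
    unfold momentConst
    rw [inv_inv, abs_of_nonneg (Real.sqrt_nonneg _), Real.sqrt_mul zero_le_two, smul_eq_mul]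
    have : lam ^ ((a - 3) / 2) = lam ^ (-a / 2) * lam ^ (a - 2) * √lam := by
      rw [Real.sqrt_eq_rpow, ← Real.rpow_add hl, ← Real.rpow_add hl]; congr 1; ring
    rw [this]; ring
  · exact ((integrable_one_add_sq_rpow ha).comp_mul_left' hc).const_mul _
  · exact ae_of_all _ fun u => by positivity

theorem lintegral_weight_orderedKernel_le {n : ℕ} {h lam a : ℝ} (hh : 0 ≤ h) (hl : 0 < lam)
    (ha0 : 0 ≤ a) (ha : a < 3 / 2) :
    ∫⁻ p : Fin n → ℝ, ENNReal.ofReal (∏ k, |p k| ^ a) * orderedKernel h p ^ 2 ≤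
      ENNReal.ofReal (Real.exp (2 * lam * h) * (momentConst a * lam ^ ((a - 3) / 2)) ^ n) := by
  have hm : Measurable fun u : ℝ =>
      ENNReal.ofReal (4 ^ a * lam ^ (-a / 2) * (lam + u ^ 2 / 2) ^ (a - 2)) := by fun_prop
  calc _ ≤ ∫⁻ p : Fin n → ℝ, ENNReal.ofReal (Real.exp (2 * lam * h)) * ∏ j : Fin n,
        ENNReal.ofReal (4 ^ a * lam ^ (-a / 2) * (lam + tailSum p j ^ 2 / 2) ^ (a - 2)) := by
        refine lintegral_mono fun p => ?_
        refine (mul_le_mul_right (pow_le_pow_left' (orderedKernel_le hh hl p) 2) _).trans ?_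
        have hb : ∀ j : Fin n, 0 < lam + tailSum p j ^ 2 / 2 := fun j => by positivity
        rw [← ENNReal.ofReal_prod_of_nonneg fun j _ => (inv_pos.2 (hb j)).le,
          ← ENNReal.ofReal_prod_of_nonneg fun j _ => by have := hb j; positivity,
          ← ENNReal.ofReal_mul (Real.exp_pos _).le, ← ENNReal.ofReal_mul (Real.exp_pos _).le,
          ← ENNReal.ofReal_pow (mul_nonneg (Real.exp_pos _).le
            (Finset.prod_nonneg fun j _ => (inv_pos.2 (hb j)).le)),
          ← ENNReal.ofReal_mul (Finset.prod_nonneg fun j _ => by positivity)]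
        refine ENNReal.ofReal_le_ofReal ?_
        rw [mul_pow, ← Real.exp_nat_mul]
        calc _ = Real.exp (2 * lam * h) * ((∏ k, |p k| ^ a) *
              (∏ j : Fin n, (lam + tailSum p j ^ 2 / 2)⁻¹) ^ 2) := by push_cast; ring_nf
          _ ≤ _ := mul_le_mul_of_nonneg_left (weight_le hl ha0 p) (Real.exp_pos _).le
    _ = ENNReal.ofReal (Real.exp (2 * lam * h)) * ∫⁻ u : Fin n → ℝ, ∏ j : Fin n,
        ENNReal.ofReal (4 ^ a * lam ^ (-a / 2) * (lam + u j ^ 2 / 2) ^ (a - 2)) := by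
        have hm' : Measurable fun u : Fin n → ℝ => ∏ j : Fin n,
            ENNReal.ofReal (4 ^ a * lam ^ (-a / 2) * (lam + u j ^ 2 / 2) ^ (a - 2)) :=
          Finset.measurable_prod _ fun j _ => hm.comp (measurable_pi_apply j)
        rw [← (measurePreserving_tailSum n).lintegral_comp hm', lintegral_const_mul]
        exact hm'.comp (measurePreserving_tailSum n).measurable
    _ = _ := by
        rw [lintegral_pi_prod (fun _ u => ENNReal.ofReal
          (4 ^ a * lam ^ (-a / 2) * (lam + u ^ 2 / 2) ^ (a - 2))) fun _ => hm]
        simp_rw [lintegral_weight hl ha]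
        have := momentConst_nonneg a
        rw [Finset.prod_const, Finset.card_univ, Fintype.card_fin,
          ← ENNReal.ofReal_pow (by positivity), ← ENNReal.ofReal_mul (Real.exp_pos _).le]

/-- One factorial is the Cauchy–Schwarz loss. The other counts the permutations, which all
contribute the same integral because the weight is symmetric. -/
theorem lintegral_weight_boxKernel_le {n : ℕ} {h lam a : ℝ} (hh : 0 ≤ h) (hl : 0 < lam)
    (ha0 : 0 ≤ a) (ha : a < 3 / 2) :
    ∫⁻ p : Fin n → ℝ, ENNReal.ofReal (∏ k, |p k| ^ a) * boxKernel h p ^ 2 ≤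
      ENNReal.ofReal ((n.factorial : ℝ) ^ 2 *
        (Real.exp (2 * lam * h) * (momentConst a * lam ^ ((a - 3) / 2)) ^ n)) := by
  have hG : Measurable fun p : Fin n → ℝ =>
      ENNReal.ofReal (∏ k, |p k| ^ a) * orderedKernel h p ^ 2 := by
    have := measurable_orderedKernel (n := n) h
    have : Measurable fun p : Fin n → ℝ => ∏ k, |p k| ^ a :=
      Finset.measurable_prod _ fun k _ => by fun_prop
    fun_prop
  calc _ ≤ ∫⁻ p : Fin n → ℝ, (n.factorial : ℝ≥0∞) * ∑ σ : Equiv.Perm (Fin n),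
        ENNReal.ofReal (∏ k, |(p ∘ σ) k| ^ a) * orderedKernel h (p ∘ σ) ^ 2 := by
        refine lintegral_mono fun p => ?_
        refine (mul_le_mul_right (boxKernel_sq_le h p) _).trans (le_of_eq ?_)
        rw [mul_left_comm, Finset.mul_sum]
        congr 1
        refine Finset.sum_congr rfl fun σ _ => ?_
        rw [← Equiv.prod_comp σ fun k => |p k| ^ a]
        rfl
    _ = (n.factorial : ℝ≥0∞) * ∑ σ : Equiv.Perm (Fin n),
        ∫⁻ p : Fin n → ℝ, ENNReal.ofReal (∏ k, |p k| ^ a) * orderedKernel h p ^ 2 := by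
        have hGσ : ∀ σ : Equiv.Perm (Fin n), Measurable fun p : Fin n → ℝ =>
            ENNReal.ofReal (∏ k, |(p ∘ σ) k| ^ a) * orderedKernel h (p ∘ σ) ^ 2 := fun σ =>
          hG.comp (measurePreserving_comp_perm σ).measurable
        rw [lintegral_const_mul _ (Finset.measurable_fun_sum _ fun σ _ => hGσ σ),
          lintegral_finsetSum _ fun σ _ => hGσ σ]
        congr 1
        exact Finset.sum_congr rfl fun σ _ => lintegral_comp_perm σ hG
    _ ≤ _ := by
        rw [Finset.sum_const, Finset.card_univ, Fintype.card_perm, Fintype.card_fin,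
          nsmul_eq_mul, ← mul_assoc, ENNReal.ofReal_mul (by positivity),
          ENNReal.ofReal_pow (by positivity), ENNReal.ofReal_natCast, sq]
        exact mul_le_mul_right (lintegral_weight_orderedKernel_le hh hl ha0 ha) _

/-! ### Increments across a fixed time and Fourier representations -/

/-- The increment `B z.1 - B z.2`, with real times. -/
noncomputable def incr {Ω : Type*} (B : ℝ≥0 → Ω → ℝ) (z : ℝ × ℝ) (ω : Ω) : ℝ :=
  B z.1.toNNReal ω - B z.2.toNNReal ω

section
variable {Ω : Type*} [MeasurableSpace Ω] {P : Measure Ω} {B : ℝ≥0 → Ω → ℝ}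

/-- Splitting at `m` gives a forward Brownian motion and an independent one run backwards, each with
covariance `min`. -/
theorem covariance_incr [IsProbabilityMeasure P] (hB : IsPreBrownianReal B P) {m : ℝ} {z w : ℝ × ℝ}
    (hz : m ≤ z.1 ∧ 0 ≤ z.2 ∧ z.2 ≤ m) (hw : m ≤ w.1 ∧ 0 ≤ w.2 ∧ w.2 ≤ m) :
    cov[incr B z, incr B w; P] =
      min (z.1 - m) (w.1 - m) + min (m - z.2) (m - w.2) := by
  have hL : ∀ t, MemLp (fun ω => B t ω) 2 P := fun t =>
    (hB.isGaussianProcess.hasGaussianLaw_eval t).memLp_two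
  have e : ∀ z, incr B z = fun ω => B z.1.toNNReal ω - B z.2.toNNReal ω := fun _ => rfl
  rw [e, e, covariance_fun_sub_fun_sub (hL _) (hL _) (hL _) (hL _)]
  simp_rw [hB.covariance_fun_eval, NNReal.coe_min]
  rw [Real.coe_toNNReal _ (by linarith), Real.coe_toNNReal _ (by linarith),
    Real.coe_toNNReal _ (by linarith), Real.coe_toNNReal _ (by linarith)]
  grind

theorem hasGaussianLaw_sum_incr (hB : IsPreBrownianReal B P) {n : ℕ} (p : Fin n → ℝ)
    (z : Fin n → ℝ × ℝ) : HasGaussianLaw (fun ω => ∑ k, p k * incr B (z k) ω) P := by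
  classical
  have : IsGaussianProcess (fun (k : Fin n) ω => p k * incr B (z k) ω) P := by
    refine hB.isGaussianProcess.of_isGaussianProcess fun k => ⟨{(z k).1.toNNReal, (z k).2.toNNReal},
      { toFun x := p k * (x ⟨(z k).1.toNNReal, by simp⟩ - x ⟨(z k).2.toNNReal, by simp⟩)
        map_add' x y := by simp; ring
        map_smul' c x := by simp; ring }, fun ω => by simp [incr]⟩
  exact this.hasGaussianLaw_fun_sum

theorem integral_exp_sum_incr [IsProbabilityMeasure P] (hB : IsPreBrownianReal B P)
    {n : ℕ} (p : Fin n → ℝ) {m : ℝ} {z : Fin n → ℝ × ℝ}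
    (hz : ∀ k, m ≤ (z k).1 ∧ 0 ≤ (z k).2 ∧ (z k).2 ≤ m) :
    ∫ ω, Complex.exp (Complex.I * (∑ k, p k * incr B (z k) ω : ℝ)) ∂P =
      (Real.exp (-brownianForm p (fun k => (z k).1 - m) / 2) *
        Real.exp (-brownianForm p (fun k => m - (z k).2) / 2) : ℝ) := by
  have hG := hasGaussianLaw_sum_incr hB p z
  have hI : ∀ k, MemLp (fun ω => incr B (z k) ω) 2 P := fun k =>
    ((hB.isGaussianProcess.hasGaussianLaw_eval _).memLp_two).sub
      ((hB.isGaussianProcess.hasGaussianLaw_eval _).memLp_two)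
  have hmean : P[fun ω => ∑ k, p k * incr B (z k) ω] = 0 := by
    rw [integral_finsetSum _ fun k _ => ((hI k).integrable one_le_two).const_mul _]
    refine Finset.sum_eq_zero fun k _ => ?_
    rw [integral_const_mul]
    unfold incr
    rw [integral_sub (hB.integrable_eval _) (hB.integrable_eval _), hB.integral_eval,
      hB.integral_eval]
    simp
  have hvar : Var[fun ω => ∑ k, p k * incr B (z k) ω; P] =
      brownianForm p (fun k => (z k).1 - m) + brownianForm p (fun k => m - (z k).2) := by
    rw [← covariance_self hG.aemeasurable,
      covariance_fun_sum_fun_sum (fun k => (hI k).const_mul _) fun k => (hI k).const_mul _]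
    unfold brownianForm
    rw [← Finset.sum_add_distrib]
    refine Finset.sum_congr rfl fun k _ => ?_
    rw [← Finset.sum_add_distrib]
    refine Finset.sum_congr rfl fun l _ => ?_
    rw [covariance_const_mul_left, covariance_const_mul_right, covariance_incr hB (hz k) (hz l)]
    ring
  have h := hG.charFun_map_eq 1
  rw [charFun_apply_real, integral_map hG.aemeasurable (by fun_prop)] at h
  simp only [Complex.ofReal_one, one_mul, Real.inner_apply, hmean, hvar] at h
  convert h using 1
  · simp only [mul_comm]
  · rw [← Real.exp_add]; push_cast; congr 1; ring

end

/-- A Brownian motion all of whose paths are continuous and all of whose values are measurable. -/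
structure IsContinuousBrownian {Ω : Type*} [MeasurableSpace Ω] (B : ℝ≥0 → Ω → ℝ)
    (P : Measure Ω) : Prop where
  pre : IsPreBrownianReal B P
  meas : ∀ t, Measurable (B t)
  cont : ∀ ω, Continuous (B · ω)

/-- `f` is the Fourier transform of the integrable function `ψ`. -/
structure IsFourier (f : ℝ → ℝ) (ψ : ℝ → ℂ) : Prop where
  integrable : Integrable ψ
  eq : ∀ x, (f x : ℂ) = ∫ p, ψ p * Complex.exp (Complex.I * (p * x : ℝ))

theorem norm_exp_I_mul (x : ℝ) : ‖Complex.exp (Complex.I * (x : ℂ))‖ = 1 := by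
  rw [mul_comm]; exact Complex.norm_exp_ofReal_mul_I x

theorem IsFourier.abs_le {f : ℝ → ℝ} {ψ : ℝ → ℂ} (h : IsFourier f ψ) (x : ℝ) :
    |f x| ≤ ∫ p, ‖ψ p‖ := by
  rw [← Real.norm_eq_abs, ← Complex.norm_real, h.eq]
  refine (norm_integral_le_integral_norm _).trans (le_of_eq ?_)
  simp_rw [norm_mul, norm_exp_I_mul, mul_one]

theorem IsFourier.continuous {f : ℝ → ℝ} {ψ : ℝ → ℂ} (h : IsFourier f ψ) : Continuous f := by
  have : Continuous fun x => (f x : ℂ) := by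
    simp_rw [h.eq]
    refine continuous_of_dominated (bound := fun p => ‖ψ p‖) (fun x => ?_) (fun x => ?_)
      h.integrable.norm (ae_of_all _ fun p => by fun_prop)
    · exact h.integrable.aestronglyMeasurable.mul
        (Continuous.aestronglyMeasurable (by fun_prop))
    · refine ae_of_all _ fun p => ?_
      rw [norm_mul, norm_exp_I_mul, mul_one]
  exact Complex.continuous_re.comp this

/-! ### Moments of the contribution of one square -/

/-- The off-diagonal square with corner `(m, m)` and side `h`. -/
def square (m h : ℝ) : Set (ℝ × ℝ) := Set.Ioc m (m + h) ×ˢ Set.Ioc (m - h) m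

theorem measurableSet_square (m h : ℝ) : MeasurableSet (square m h) :=
  measurableSet_Ioc.prod measurableSet_Ioc

instance (m h : ℝ) : IsFiniteMeasure ((volume : Measure (ℝ × ℝ)).restrict (square m h)) := by
  constructor
  rw [Measure.restrict_apply_univ, square, Measure.volume_eq_prod, Measure.prod_prod]
  exact ENNReal.mul_lt_top (by simp) (by simp)

theorem measurable_incr_of_continuous {Ω : Type*} [MeasurableSpace Ω] {B : ℝ≥0 → Ω → ℝ}
    (hc : ∀ ω, Continuous (B · ω)) (hm : ∀ t, Measurable (B t)) :
    Measurable fun q : (ℝ × ℝ) × Ω => incr B q.1 q.2 := by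
  have h : Measurable (Function.uncurry B) :=
    measurable_uncurry_of_continuous_of_measurable hc hm
  exact (h.comp ((measurable_real_toNNReal.comp
    (measurable_fst.comp measurable_fst)).prodMk measurable_snd)).sub
      (h.comp ((measurable_real_toNNReal.comp
        (measurable_snd.comp measurable_fst)).prodMk measurable_snd))

section
variable {Ω : Type*} [MeasurableSpace Ω] {P : Measure Ω} {B : ℝ≥0 → Ω → ℝ}

theorem IsContinuousBrownian.measurable_incr (hB : IsContinuousBrownian B P) :
    Measurable fun q : (ℝ × ℝ) × Ω => incr B q.1 q.2 :=
  measurable_incr_of_continuous hB.cont hB.meas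

theorem IsContinuousBrownian.measurable_incr_right (hB : IsContinuousBrownian B P) (z : ℝ × ℝ) :
    Measurable (incr B z) := hB.measurable_incr.comp measurable_prodMk_left

theorem measurable_brownianForm {α : Type*} [MeasurableSpace α] {n : ℕ} {p t : α → Fin n → ℝ}
    (hp : Measurable p) (ht : Measurable t) : Measurable fun a => brownianForm (p a) (t a) :=
  continuous_brownianForm.measurable.comp (hp.prodMk ht)

/-- The contribution of one square to the regularised self-intersection functional. -/
noncomputable def squareIntegral (B : ℝ≥0 → Ω → ℝ) (f : ℝ → ℝ) (m h : ℝ) (ω : Ω) : ℝ :=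
  ∫ z in square m h, f (incr B z ω)

/-- Expand every factor by its Fourier integral and take the expectation inside. Fubini applies
because the exponentials have modulus `1` and `∏ ψ (p k)` is integrable; the Gaussian characteristic
function then gives the two factors. -/
theorem enorm_integral_prod_le [IsProbabilityMeasure P] (hB : IsContinuousBrownian B P)
    {f : ℝ → ℝ} {ψ : ℝ → ℂ} (hf : IsFourier f ψ) {n : ℕ} {m : ℝ} {z : Fin n → ℝ × ℝ}
    (hz : ∀ k, m ≤ (z k).1 ∧ 0 ≤ (z k).2 ∧ (z k).2 ≤ m) :
    ‖∫ ω, ∏ k, f (incr B (z k) ω) ∂P‖ₑ ≤ ∫⁻ p : Fin n → ℝ, ENNReal.ofReal (∏ k, ‖ψ (p k)‖) *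
      (ENNReal.ofReal (Real.exp (-brownianForm p (fun k => (z k).1 - m) / 2)) *
        ENNReal.ofReal (Real.exp (-brownianForm p (fun k => m - (z k).2) / 2))) := by
  have hψ : Integrable fun p : Fin n → ℝ => ∏ k, ψ (p k) :=
    Integrable.fintype_prod fun _ => hf.integrable
  have hprod : ∀ (p : Fin n → ℝ) ω, ∏ k, (ψ (p k) * Complex.exp (Complex.I *
      (p k * incr B (z k) ω : ℝ))) = (∏ k, ψ (p k)) *
        Complex.exp (Complex.I * (∑ k, p k * incr B (z k) ω : ℝ)) := by
    intro p ω
    rw [Finset.prod_mul_distrib, ← Complex.exp_sum, Complex.ofReal_sum, Finset.mul_sum]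
  have h1 : ((∫ ω, ∏ k, f (incr B (z k) ω) ∂P : ℝ) : ℂ) =
      ∫ p : Fin n → ℝ, (∏ k, ψ (p k)) *
        (Real.exp (-brownianForm p (fun k => (z k).1 - m) / 2) *
        Real.exp (-brownianForm p (fun k => m - (z k).2) / 2) : ℝ) := by
    rw [← integral_complex_ofReal]
    simp_rw [Complex.ofReal_prod, hf.eq, ← integral_fintype_prod_volume_eq_prod
      (𝕜 := ℂ) (fun k p => ψ p * Complex.exp (Complex.I * (p * incr B (z k) _ : ℝ))), hprod]
    rw [integral_integral_swap]
    · refine integral_congr_ae (ae_of_all _ fun p => ?_)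
      simp only
      rw [integral_const_mul, integral_exp_sum_incr hB.pre p hz]
    · have hm : Measurable fun q : Ω × (Fin n → ℝ) =>
          Complex.exp (Complex.I * (∑ k, q.2 k * incr B (z k) q.1 : ℝ)) := by
        have : ∀ k, Measurable fun q : Ω × (Fin n → ℝ) => q.2 k * incr B (z k) q.1 := fun k =>
          ((measurable_pi_apply k).comp measurable_snd).mul
            ((hB.measurable_incr_right _).comp measurable_fst)
        fun_prop
      refine (hψ.comp_snd P).mono (((hψ.comp_snd P).aestronglyMeasurable).mul
        hm.aestronglyMeasurable) (ae_of_all _ fun q => ?_)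
      simp only [Function.uncurry]
      rw [norm_mul, norm_exp_I_mul, mul_one]
  have h2 : ‖∫ ω, ∏ k, f (incr B (z k) ω) ∂P‖ₑ =
      ‖((∫ ω, ∏ k, f (incr B (z k) ω) ∂P : ℝ) : ℂ)‖ₑ := by
    simp [← ofReal_norm, Complex.norm_real]
  rw [h2, h1]
  refine (enorm_integral_le_lintegral_enorm _).trans (le_of_eq (lintegral_congr fun p => ?_))
  rw [enorm_mul, ← ENNReal.ofReal_mul (Real.exp_pos _).le, ← ofReal_norm, norm_prod,
    ← ofReal_norm, Complex.norm_real, Real.norm_of_nonneg (by positivity)]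

/-- The two time coordinates integrate separately. A translation maps one block, and a reflection
the other, into the box `[0, h]^n`, so each is bounded by the same kernel. -/
theorem lintegral_square_pow_le {n : ℕ} (p : Fin n → ℝ) (m h : ℝ) :
    ∫⁻ z : Fin n → ℝ × ℝ,
      (ENNReal.ofReal (Real.exp (-brownianForm p (fun k => (z k).1 - m) / 2)) *
        ENNReal.ofReal (Real.exp (-brownianForm p (fun k => m - (z k).2) / 2)))
      ∂(Measure.pi fun _ => volume.restrict (square m h)) ≤ boxKernel h p ^ 2 := by
  let g : (Fin n → ℝ) → ℝ≥0∞ := fun t => ENNReal.ofReal (Real.exp (-brownianForm p t / 2))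
  have hg : Measurable g := measurable_exp_brownianForm_right p
  have hμ : (volume : Measure (ℝ × ℝ)).restrict (square m h) =
      (volume.restrict (Set.Ioc m (m + h))).prod (volume.restrict (Set.Ioc (m - h) m)) := by
    rw [Measure.prod_restrict]; rfl
  rw [hμ]
  have e := measurePreserving_arrowProdEquivProdArrow ℝ ℝ (Fin n)
    (fun _ => volume.restrict (Set.Ioc m (m + h))) (fun _ => volume.restrict (Set.Ioc (m - h) m))
  have h1 : Measurable fun t : Fin n → ℝ => g (fun k => t k - m) :=
    hg.comp (measurable_pi_lambda _ fun k => by fun_prop)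
  have h2 : Measurable fun t : Fin n → ℝ => g (fun k => m - t k) :=
    hg.comp (measurable_pi_lambda _ fun k => by fun_prop)
  have key : ∫⁻ z : Fin n → ℝ × ℝ, g (fun k => (z k).1 - m) * g (fun k => m - (z k).2)
      ∂(Measure.pi fun _ => (volume.restrict (Set.Ioc m (m + h))).prod
        (volume.restrict (Set.Ioc (m - h) m))) =
      ∫⁻ q : (Fin n → ℝ) × (Fin n → ℝ), g (fun k => q.1 k - m) * g (fun k => m - q.2 k)
        ∂((Measure.pi fun _ => volume.restrict (Set.Ioc m (m + h))).prod
          (Measure.pi fun _ => volume.restrict (Set.Ioc (m - h) m))) :=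
    e.lintegral_comp (f := fun q : (Fin n → ℝ) × (Fin n → ℝ) =>
      g (fun k => q.1 k - m) * g (fun k => m - q.2 k))
      ((h1.comp measurable_fst).mul (h2.comp measurable_snd))
  refine key.le.trans ?_
  rw [lintegral_prod_mul h1.aemeasurable h2.aemeasurable, sq, ← Measure.restrict_pi_pi,
    ← Measure.restrict_pi_pi]
  refine mul_le_mul' ?_ ?_
  · rw [← lintegral_indicator (MeasurableSet.univ_pi fun _ => measurableSet_Ioc)]
    refine le_trans ?_ (lintegral_sub_right_eq_self
      ({t : Fin n → ℝ | ∀ k, t k ∈ Set.Icc 0 h}.indicator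
      fun t => ENNReal.ofReal (Real.exp (-brownianForm p t / 2))) (fun _ => m)).le
    refine lintegral_mono fun t => Set.indicator_apply_le' (fun ht => ?_) fun _ => bot_le
    rw [Set.indicator_of_mem]
    · rfl
    · intro k
      have := ht k (Set.mem_univ _)
      simp only [Pi.sub_apply, Set.mem_Icc, Set.mem_Ioc] at this ⊢
      constructor <;> linarith
  · rw [← lintegral_indicator (MeasurableSet.univ_pi fun _ => measurableSet_Ioc)]
    refine le_trans ?_ (lintegral_sub_left_eq_self
      ({t : Fin n → ℝ | ∀ k, t k ∈ Set.Icc 0 h}.indicator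
      fun t => ENNReal.ofReal (Real.exp (-brownianForm p t / 2))) (fun _ => m)).le
    refine lintegral_mono fun t => Set.indicator_apply_le' (fun ht => ?_) fun _ => bot_le
    rw [Set.indicator_of_mem]
    · rfl
    · intro k
      have := ht k (Set.mem_univ _)
      simp only [Pi.sub_apply, Set.mem_Icc, Set.mem_Ioc] at this ⊢
      constructor <;> linarith

theorem enorm_moment_squareIntegral_le [IsProbabilityMeasure P] (hB : IsContinuousBrownian B P)
    {f : ℝ → ℝ} {ψ : ℝ → ℂ} (hf : IsFourier f ψ) (n : ℕ) {m h : ℝ} (hm : h ≤ m) :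
    ‖∫ ω, squareIntegral B f m h ω ^ n ∂P‖ₑ ≤
      ∫⁻ p : Fin n → ℝ, ENNReal.ofReal (∏ k, ‖ψ (p k)‖) * boxKernel h p ^ 2 := by
  let μ : Measure (Fin n → ℝ × ℝ) := Measure.pi fun _ => volume.restrict (square m h)
  have hpow : ∀ ω, squareIntegral B f m h ω ^ n =
      ∫ z : Fin n → ℝ × ℝ, ∏ k, f (incr B (z k) ω) ∂μ := by
    intro ω
    rw [integral_fintype_prod_eq_pow (fun z => f (incr B z ω)), Fintype.card_fin]
    rfl
  have hmeas : Measurable fun q : Ω × (Fin n → ℝ × ℝ) => ∏ k, f (incr B (q.2 k) q.1) :=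
    Finset.measurable_prod _ fun k _ => by
      have h1 : Measurable fun q : Ω × (Fin n → ℝ × ℝ) => (q.2 k, q.1) := by fun_prop
      exact hf.continuous.measurable.comp (hB.measurable_incr.comp h1)
  simp_rw [hpow]
  rw [integral_integral_swap]
  swap
  · refine (integrable_const ((∫ p, ‖ψ p‖) ^ n)).mono' hmeas.aestronglyMeasurable
      (ae_of_all _ fun q => ?_)
    simp only [Function.uncurry, norm_prod]
    refine (Finset.prod_le_prod (fun _ _ => norm_nonneg _) fun k _ =>
      hf.abs_le (incr B (q.2 k) q.1)).trans ?_
    simp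
  refine (enorm_integral_le_lintegral_enorm _).trans ?_
  -- Since `h ≤ m`, the square contains only nonnegative times, where `Real.toNNReal` does not
  -- truncate.
  have hae : ∀ᵐ z ∂μ, ∀ k, m ≤ (z k).1 ∧ 0 ≤ (z k).2 ∧ (z k).2 ≤ m := by
    have : μ = volume.restrict (Set.univ.pi fun _ => square m h) := by
      rw [volume_pi, Measure.restrict_pi_pi]
    rw [this]
    filter_upwards [ae_restrict_mem (MeasurableSet.univ_pi fun _ => measurableSet_square m h)]
      with z hz k
    obtain ⟨h1, h2⟩ := hz k (Set.mem_univ _)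
    simp only [Set.mem_Ioc] at h1 h2
    exact ⟨h1.1.le, by linarith, h2.2⟩
  refine (lintegral_mono_ae (hae.mono fun z hz => enorm_integral_prod_le hB hf hz)).trans ?_
  have hψ : AEMeasurable fun p : Fin n → ℝ => ∏ k, ψ (p k) :=
    (Integrable.fintype_prod (E := ℝ) fun _ : Fin n => hf.integrable).aemeasurable
  have hψ' : AEMeasurable fun p : Fin n → ℝ => ENNReal.ofReal (∏ k, ‖ψ (p k)‖) := by
    simp_rw [← norm_prod]; exact hψ.norm.ennreal_ofReal
  have hk : Measurable fun q : (Fin n → ℝ × ℝ) × (Fin n → ℝ) =>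
      (ENNReal.ofReal (Real.exp (-brownianForm q.2 (fun k => (q.1 k).1 - m) / 2)) *
        ENNReal.ofReal (Real.exp (-brownianForm q.2 (fun k => m - (q.1 k).2) / 2))) := by
    have e1 : Measurable fun q : (Fin n → ℝ × ℝ) × (Fin n → ℝ) =>
        brownianForm q.2 (fun k => (q.1 k).1 - m) :=
      measurable_brownianForm measurable_snd (by fun_prop)
    have e2 : Measurable fun q : (Fin n → ℝ × ℝ) × (Fin n → ℝ) =>
        brownianForm q.2 (fun k => m - (q.1 k).2) :=
      measurable_brownianForm measurable_snd (by fun_prop)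
    fun_prop
  rw [lintegral_lintegral_swap]
  · refine lintegral_mono fun p => ?_
    simp only
    rw [lintegral_const_mul' _ _ ENNReal.ofReal_ne_top]
    exact mul_le_mul_right (lintegral_square_pow_le p m h) _
  · exact (hψ'.comp_quasiMeasurePreserving Measure.quasiMeasurePreserving_snd).mul hk.aemeasurable

end

theorem abs_setIntegral_square_le {g : ℝ × ℝ → ℝ} {C : ℝ} (hg : ∀ z, |g z| ≤ C) {m h : ℝ}
    (hh : 0 ≤ h) : |∫ z in square m h, g z| ≤ C * h ^ 2 := by
  have := norm_setIntegral_le_of_norm_le_const (μ := volume) (s := square m h) (f := g) (C := C)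
    (by rw [← Measure.restrict_apply_univ]; exact measure_lt_top _ _) fun z _ => hg z
  rw [Real.norm_eq_abs] at this
  refine this.trans (le_of_eq ?_)
  rw [square, Measure.volume_eq_prod, measureReal_prod_prod]
  simp [hh, sq]

theorem abs_squareIntegral_le {Ω : Type*} {B : ℝ≥0 → Ω → ℝ} {f : ℝ → ℝ} {C : ℝ}
    (hf : ∀ x, |f x| ≤ C) {m h : ℝ} (hh : 0 ≤ h)
    (ω : Ω) : |squareIntegral B f m h ω| ≤ C * h ^ 2 :=
  abs_setIntegral_square_le (fun _ => hf _) hh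

section
variable {Ω : Type*} [MeasurableSpace Ω] {P : Measure Ω} {B : ℝ≥0 → Ω → ℝ}

theorem measurable_squareIntegral (hc : ∀ ω, Continuous (B · ω)) (hm : ∀ t, Measurable (B t))
    {f : ℝ → ℝ} (hf : Continuous f) (m h : ℝ) : Measurable (squareIntegral B f m h) := by
  have h1 : Measurable fun q : Ω × (ℝ × ℝ) => f (incr B q.2 q.1) :=
    hf.measurable.comp ((measurable_incr_of_continuous hc hm).comp measurable_swap)
  exact (h1.stronglyMeasurable.integral_prod_right' (ν := volume.restrict (square m h))).measurable

/-- An odd function of a centred Gaussian has mean zero. Centring is what removes the linear term of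
the moment generating function. -/
theorem integral_squareIntegral_eq_zero [IsProbabilityMeasure P] (hB : IsContinuousBrownian B P)
    {f : ℝ → ℝ} (hf : Continuous f) {C : ℝ} (hC : ∀ x, |f x| ≤ C) (hodd : ∀ x, f (-x) = -f x)
    (m h : ℝ) : ∫ ω, squareIntegral B f m h ω ∂P = 0 := by
  unfold squareIntegral
  rw [integral_integral_swap]
  · refine integral_eq_zero_of_ae (ae_of_all _ fun z => ?_)
    have hl := hB.pre.hasLaw_sub z.1.toNNReal z.2.toNNReal
    have h1 : ∫ ω, f (incr B z ω) ∂P = ∫ x, f x ∂(gaussianReal 0 _) := hl.integral_comp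
      hf.aestronglyMeasurable
    have h2 : ∀ v, ∫ x, f x ∂(gaussianReal 0 v) = 0 := by
      intro v
      have h3 : ∫ x, f (-x) ∂(gaussianReal 0 v) = ∫ x, f x ∂(gaussianReal 0 v) := by
        conv_rhs => rw [← neg_zero (G := ℝ), ← gaussianReal_map_neg]
        rw [integral_map (by fun_prop) hf.aestronglyMeasurable]
      simp_rw [hodd, integral_neg] at h3
      linarith
    exact h1.trans (h2 _)
  · have h1 : Measurable fun q : Ω × (ℝ × ℝ) => f (incr B q.2 q.1) :=
      hf.measurable.comp (hB.measurable_incr.comp measurable_swap)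
    exact (integrable_const C).mono' h1.aestronglyMeasurable (ae_of_all _ fun q => hC _)

theorem abs_moment_squareIntegral_le [IsProbabilityMeasure P] (hB : IsContinuousBrownian B P)
    {f : ℝ → ℝ} {ψ : ℝ → ℂ} (hf : IsFourier f ψ) {K a : ℝ} (hK : 0 ≤ K)
    (hψ : ∀ p, ‖ψ p‖ ≤ K * |p| ^ a) (ha0 : 0 ≤ a) (ha : a < 3 / 2) (n : ℕ) {m h lam : ℝ}
    (hh : 0 ≤ h) (hm : h ≤ m) (hl : 0 < lam) :
    |∫ ω, squareIntegral B f m h ω ^ n ∂P| ≤ K ^ n * ((n.factorial : ℝ) ^ 2 *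
        (Real.exp (2 * lam * h) * (momentConst a * lam ^ ((a - 3) / 2)) ^ n)) := by
  have hc := momentConst_nonneg a
  rw [← ENNReal.ofReal_le_ofReal_iff (by positivity), ENNReal.ofReal_mul (by positivity),
    ← Real.norm_eq_abs, ofReal_norm]
  refine (enorm_moment_squareIntegral_le hB hf n hm).trans ?_
  refine le_trans ?_ (mul_le_mul_right (lintegral_weight_boxKernel_le hh hl ha0 ha) _)
  rw [← lintegral_const_mul' _ _ ENNReal.ofReal_ne_top]
  refine lintegral_mono fun p => ?_
  rw [← mul_assoc, ← ENNReal.ofReal_mul (by positivity)]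
  refine mul_le_mul_left (ENNReal.ofReal_le_ofReal ?_) _
  refine (Finset.prod_le_prod (fun _ _ => norm_nonneg _) fun k _ => hψ (p k)).trans ?_
  simp [Finset.prod_mul_distrib]

/-- The constant in the exponential bounds. -/
noncomputable def expConst : ℝ := Real.exp 2 * momentConst 1

/-- The choice `lam = n / h` turns the exponential into `exp 2 ^ n` and the power of `lam` into `(h
/ n) ^ n`, whose `n ^ n` absorbs one of the two factorials. -/
theorem abs_moment_squareIntegral_le_factorial [IsProbabilityMeasure P]
    (hB : IsContinuousBrownian B P) {f : ℝ → ℝ} {ψ : ℝ → ℂ} (hf : IsFourier f ψ) {K : ℝ}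
    (hK : 0 ≤ K) (hψ : ∀ p, ‖ψ p‖ ≤ K * |p|) {n : ℕ} (hn : n ≠ 0) {m h : ℝ}
    (hh : 0 < h) (hm : h ≤ m) :
    |∫ ω, squareIntegral B f m h ω ^ n ∂P| ≤ n.factorial * (K * expConst * h) ^ n := by
  have hn' : (0 : ℝ) < n := by positivity
  have hc := momentConst_nonneg 1
  have h1 := abs_moment_squareIntegral_le hB hf hK (a := 1) (by simpa using hψ) zero_le_one
    (by norm_num) n hh.le hm (lam := n / h) (by positivity)
  refine h1.trans ?_
  have e1 : ((n : ℝ) / h) ^ (((1 : ℝ) - 3) / 2) = h / n := by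
    norm_num [Real.rpow_neg_one]
  have e2 : Real.exp (2 * (n / h) * h) = Real.exp 2 ^ n := by
    rw [← Real.exp_nat_mul]; congr 1; field_simp
  have e3 : (n.factorial : ℝ) ≤ (n : ℝ) ^ n := by exact_mod_cast Nat.factorial_le_pow n
  rw [e1, e2]
  unfold expConst
  calc _ = (n.factorial : ℝ) * ((n.factorial / (n : ℝ) ^ n) *
        (K * (Real.exp 2 * momentConst 1) * h) ^ n) := by
        simp only [mul_pow, div_pow]; field_simp
    _ ≤ (n.factorial : ℝ) * (1 * (K * (Real.exp 2 * momentConst 1) * h) ^ n) := by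
        gcongr
        exact div_le_one_of_le₀ e3 (by positivity)
    _ = _ := by rw [one_mul]

theorem hasSum_mgf_of_bounded [IsProbabilityMeasure P] {Y : Ω → ℝ} (hY : Measurable Y) {C : ℝ}
    (hC : ∀ ω, |Y ω| ≤ C) (l : ℝ) :
    HasSum (fun n : ℕ => l ^ n * (∫ ω, Y ω ^ n ∂P) / n.factorial) (mgf Y P l) := by
  have hCn : ∀ n ω, ‖(l * Y ω) ^ n / n.factorial‖ ≤ (|l| * C) ^ n / n.factorial := by
    intro n ω
    rw [norm_div, norm_pow, norm_mul, Real.norm_eq_abs, Real.norm_eq_abs, Real.norm_natCast]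
    gcongr
    exact hC ω
  have hint : ∀ n : ℕ, Integrable (fun ω => (l * Y ω) ^ n / n.factorial) P := fun n =>
    (integrable_const ((|l| * C) ^ n / n.factorial)).mono'
      (by fun_prop : Measurable _).aestronglyMeasurable (ae_of_all _ (hCn n))
  have h1 := hasSum_integral_of_summable_integral_norm hint (by
    refine Summable.of_nonneg_of_le (fun n => integral_nonneg fun _ => norm_nonneg _) (fun n => ?_)
      (Real.summable_pow_div_factorial (|l| * C))
    refine (integral_mono (hint n).norm (integrable_const _) (hCn n)).trans ?_
    simp)
  have h2 : ∀ ω, ∑' n : ℕ, (l * Y ω) ^ n / n.factorial = Real.exp (l * Y ω) := fun ω => by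
    rw [Real.exp_eq_exp_ℝ]
    exact (NormedSpace.expSeries_div_hasSum_exp (l * Y ω)).tsum_eq
  simp_rw [h2] at h1
  have e : (fun n : ℕ => l ^ n * (∫ ω, Y ω ^ n ∂P) / n.factorial) =
      fun n : ℕ => ∫ ω, (l * Y ω) ^ n / n.factorial ∂P := by
    funext n
    simp_rw [mul_pow]
    rw [integral_div, integral_const_mul]
  rw [e]
  exact h1

/-- With `x = |l| * A`, the moment series is dominated by the geometric series without its linear
term, and `(1 - x)⁻¹ - x ≤ 1 + 2 * x²` for `0 ≤ x ≤ 1/2`. -/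
theorem mgf_le_of_moment_le [IsProbabilityMeasure P] {Y : Ω → ℝ} (hY : Measurable Y) {C : ℝ}
    (hC : ∀ ω, |Y ω| ≤ C) (h0 : ∫ ω, Y ω ∂P = 0) {A : ℝ} (hA : 0 ≤ A)
    (hmom : ∀ n : ℕ, n ≠ 0 → |∫ ω, Y ω ^ n ∂P| ≤ n.factorial * A ^ n) {l : ℝ}
    (hl : |l| * A ≤ 1 / 2) : mgf Y P l ≤ Real.exp (2 * (|l| * A) ^ 2) := by
  have hs := hasSum_mgf_of_bounded (P := P) hY hC l
  set x := |l| * A with hx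
  have hx0 : 0 ≤ x := by positivity
  have hg : HasSum (fun n : ℕ => x ^ n) (1 - x)⁻¹ :=
    hasSum_geometric_of_lt_one hx0 (by linarith)
  have hg' : HasSum (fun n : ℕ => x ^ n - if n = 1 then x else 0) ((1 - x)⁻¹ - x) :=
    hg.sub (hasSum_ite_eq 1 x)
  have hle : mgf Y P l ≤ (1 - x)⁻¹ - x := by
    refine hasSum_le (fun n => ?_) hs hg'
    rcases Nat.eq_zero_or_pos n with rfl | hn
    · simp
    · by_cases h1 : n = 1
      · subst h1; simp [h0]
      · simp only [h1, if_false, sub_zero]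
        have hf : (0 : ℝ) < n.factorial := by positivity
        rw [div_le_iff₀ hf]
        refine (le_abs_self _).trans ?_
        rw [abs_mul, abs_pow, hx, mul_pow, mul_assoc, mul_comm (A ^ n)]
        exact mul_le_mul_of_nonneg_left (hmom n hn.ne') (by positivity)
  have h3 : (1 - x)⁻¹ - x ≤ 1 + 2 * x ^ 2 := by
    have : 0 < 1 - x := by linarith
    rw [sub_le_iff_le_add, inv_le_iff_one_le_mul₀ this]
    nlinarith [mul_nonneg hx0 hx0, mul_nonneg (mul_nonneg hx0 hx0) hx0]
  have := Real.add_one_le_exp (2 * x ^ 2)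
  linarith

end

/-! ### Rows of independent squares -/

theorem squareIntegral_congr {Ω : Type*} {B B' : ℝ≥0 → Ω → ℝ} (f : ℝ → ℝ) {m h : ℝ}
    (H : ∀ z ∈ square m h, ∀ ω, incr B z ω = incr B' z ω) :
    squareIntegral B f m h = squareIntegral B' f m h := by
  funext ω
  exact setIntegral_congr_fun (measurableSet_square m h) fun z hz => by simp only [H z hz ω]

theorem measurable_squareIntegral_past {Ω : Type*} {B : ℝ≥0 → Ω → ℝ}
    (hc : ∀ ω, Continuous (B · ω)) {f : ℝ → ℝ} (hf : Continuous f) {m h : ℝ} {t₀ : ℝ≥0}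
    (hmh : m + h ≤ t₀) :
    Measurable[MeasurableSpace.comap (fun ω (t : Set.Iic t₀) => B t ω) MeasurableSpace.pi]
      (squareIntegral B f m h) := by
  let mΩ : MeasurableSpace Ω :=
    MeasurableSpace.comap (fun ω (t : Set.Iic t₀) => B t ω) MeasurableSpace.pi
  -- The path stopped at `t₀` agrees with `B` on the times used and is measurable for the past.
  rw [squareIntegral_congr (B' := fun t ω => B (min t t₀) ω)]
  · refine measurable_squareIntegral (fun ω => ?_) (fun t => ?_) hf m h
    · exact (hc ω).comp (by fun_prop)
    · exact (measurable_pi_apply (⟨min t t₀, Set.mem_Iic.2 (min_le_right t t₀)⟩ : Set.Iic t₀)).comp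
        (comap_measurable fun ω (t : Set.Iic t₀) => B t ω)
  · intro z hz ω
    obtain ⟨h1, h2⟩ := hz
    simp only [Set.mem_Ioc] at h1 h2
    unfold incr
    simp only
    rw [min_eq_left (Real.toNNReal_le_iff_le_coe.2 (by linarith)),
      min_eq_left (Real.toNNReal_le_iff_le_coe.2 (by linarith))]

theorem measurable_squareIntegral_future {Ω : Type*} {B : ℝ≥0 → Ω → ℝ}
    (hc : ∀ ω, Continuous (B · ω)) {f : ℝ → ℝ} (hf : Continuous f) {m h : ℝ} {t₀ : ℝ≥0}
    (hmh : t₀ ≤ m - h) :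
    Measurable[MeasurableSpace.comap (fun ω (t : ℝ≥0) => B (t₀ + t) ω - B t₀ ω)
      MeasurableSpace.pi] (squareIntegral B f m h) := by
  let mΩ : MeasurableSpace Ω :=
    MeasurableSpace.comap (fun ω (t : ℝ≥0) => B (t₀ + t) ω - B t₀ ω) MeasurableSpace.pi
  -- Truncated subtraction freezes the path before `t₀`; subtracting `B t₀` does not change
  -- increments.
  rw [squareIntegral_congr (B' := fun t ω => B (t₀ + (t - t₀)) ω - B t₀ ω)]
  · refine measurable_squareIntegral (fun ω => ?_) (fun t => ?_) hf m h
    · exact ((hc ω).comp (by fun_prop)).sub continuous_const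
    · exact (measurable_pi_apply (t - t₀)).comp
        (comap_measurable fun ω (t : ℝ≥0) => B (t₀ + t) ω - B t₀ ω)
  · intro z hz ω
    obtain ⟨h1, h2⟩ := hz
    simp only [Set.mem_Ioc] at h1 h2
    unfold incr
    simp only
    rw [add_tsub_cancel_of_le (NNReal.le_toNNReal_of_coe_le (by linarith)),
      add_tsub_cancel_of_le (NNReal.le_toNNReal_of_coe_le (by linarith))]
    ring

/-- Sum of the contributions of the first `J` squares of side `h` along the diagonal. -/
noncomputable def rowSum {Ω : Type*} (B : ℝ≥0 → Ω → ℝ) (f : ℝ → ℝ) (h : ℝ) (J : ℕ) (ω : Ω) : ℝ :=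
  ∑ j ∈ Finset.range J, squareIntegral B f ((2 * j + 1) * h) h ω

theorem rowSum_succ {Ω : Type*} {B : ℝ≥0 → Ω → ℝ} (f : ℝ → ℝ) (h : ℝ) (J : ℕ) :
    rowSum B f h (J + 1) = rowSum B f h J + squareIntegral B f ((2 * J + 1) * h) h := by
  funext ω
  simp [rowSum, Finset.sum_range_succ]

section
variable {Ω : Type*} [MeasurableSpace Ω] {P : Measure Ω} {B : ℝ≥0 → Ω → ℝ}

theorem measurable_rowSum (hB : IsContinuousBrownian B P) {f : ℝ → ℝ} (hf : Continuous f) (h : ℝ)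
    (J : ℕ) : Measurable (rowSum B f h J) :=
  Finset.measurable_fun_sum _ fun _ _ => measurable_squareIntegral hB.cont hB.meas hf _ _

/-- Square `j` only sees the path on `[2jh, 2(j+1)h]`, so time `2Jh` separates the first `J` squares
from the next one, and the Markov property applies there. -/
theorem indepFun_rowSum (hB : IsContinuousBrownian B P) {f : ℝ → ℝ} (hf : Continuous f) {h : ℝ}
    (hh : 0 ≤ h) (J : ℕ) :
    IndepFun (rowSum B f h J) (squareIntegral B f ((2 * J + 1) * h) h) P := by
  let t₀ : ℝ≥0 := ⟨2 * J * h, by positivity⟩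
  have hi := (hB.pre.indepFun_shift t₀).symm
  rw [IndepFun_iff_Indep] at hi ⊢
  refine indep_of_indep_of_le_left (indep_of_indep_of_le_right hi ?_) ?_
  · rw [← measurable_iff_comap_le]
    refine measurable_squareIntegral_future hB.cont hf ?_
    change 2 * J * h ≤ _
    linarith
  · rw [← measurable_iff_comap_le]
    refine Finset.measurable_fun_sum _ fun j hj => measurable_squareIntegral_past hB.cont hf ?_
    change _ ≤ 2 * J * h
    have : (j : ℝ) + 1 ≤ J := by exact_mod_cast Finset.mem_range.1 hj
    nlinarith

theorem mgf_rowSum_le [IsProbabilityMeasure P] (hB : IsContinuousBrownian B P)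
    {f : ℝ → ℝ} {ψ : ℝ → ℂ} (hf : IsFourier f ψ) (hodd : ∀ x, f (-x) = -f x) {K : ℝ}
    (hK : 0 ≤ K) (hψ : ∀ p, ‖ψ p‖ ≤ K * |p|) {h : ℝ} (hh : 0 < h) {l : ℝ}
    (hl : |l| * (K * expConst * h) ≤ 1 / 2) (J : ℕ) :
    mgf (rowSum B f h J) P l ≤ Real.exp (2 * (|l| * (K * expConst * h)) ^ 2) ^ J := by
  have hA : 0 ≤ K * expConst * h := by
    have := momentConst_nonneg 1
    unfold expConst; positivity
  induction J with
  | zero => simp [mgf, rowSum]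
  | succ J ih =>
    have hm : h ≤ (2 * J + 1) * h := by nlinarith [mul_nonneg (Nat.cast_nonneg (α := ℝ) J) hh.le]
    have hms := measurable_squareIntegral hB.cont hB.meas hf.continuous ((2 * J + 1) * h) h
    rw [rowSum_succ, (indepFun_rowSum hB hf.continuous hh.le J).mgf_add'
      (measurable_rowSum hB hf.continuous h J).aestronglyMeasurable hms.aestronglyMeasurable,
      pow_succ]
    refine mul_le_mul ih ?_ mgf_nonneg (by positivity)
    exact mgf_le_of_moment_le hms (abs_squareIntegral_le hf.abs_le hh.le)
      (integral_squareIntegral_eq_zero hB hf.continuous hf.abs_le hodd _ _) hA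
      (fun n hn => abs_moment_squareIntegral_le_factorial hB hf hK hψ hn hh hm) hl

theorem abs_rowSum_le {Ω : Type*} {B : ℝ≥0 → Ω → ℝ} {f : ℝ → ℝ} {C : ℝ} (hf : ∀ x, |f x| ≤ C)
    {h : ℝ} (hh : 0 ≤ h) (J : ℕ) (ω : Ω) : |rowSum B f h J ω| ≤ J * (C * h ^ 2) := by
  refine (Finset.abs_sum_le_sum_abs _ _).trans ?_
  refine (Finset.sum_le_sum fun j _ => abs_squareIntegral_le hf hh ω).trans ?_
  simp

theorem integral_rowSum_sq_le [IsProbabilityMeasure P] (hB : IsContinuousBrownian B P)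
    {f : ℝ → ℝ} {ψ : ℝ → ℂ} (hf : IsFourier f ψ) (hodd : ∀ x, f (-x) = -f x) {K a : ℝ}
    (hK : 0 ≤ K) (hψ : ∀ p, ‖ψ p‖ ≤ K * |p| ^ a) (ha0 : 0 ≤ a) (ha : a < 3 / 2) {h : ℝ}
    (hh : 0 < h) (J : ℕ) :
    ∫ ω, rowSum B f h J ω ^ 2 ∂P ≤
      J * (4 * Real.exp 2 * momentConst a ^ 2 * K ^ 2 * h ^ (3 - a)) := by
  induction J with
  | zero => simp [rowSum]
  | succ J ih =>
    set ξ := squareIntegral B f ((2 * J + 1) * h) h with hξ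
    have hm : h ≤ (2 * J + 1) * h := by nlinarith [mul_nonneg (Nat.cast_nonneg (α := ℝ) J) hh.le]
    have hms : Measurable ξ :=
      measurable_squareIntegral hB.cont hB.meas hf.continuous ((2 * J + 1) * h) h
    have hmr := measurable_rowSum hB hf.continuous h J
    have hbs := abs_squareIntegral_le (B := B) hf.abs_le (m := (2 * J + 1) * h) hh.le
    have hbr := abs_rowSum_le (B := B) hf.abs_le hh.le J
    have hind := indepFun_rowSum hB hf.continuous hh.le J
    have h0 : ∫ ω, ξ ω ∂P = 0 :=
      integral_squareIntegral_eq_zero hB hf.continuous hf.abs_le hodd _ _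
    have h2 : ∫ ω, ξ ω ^ 2 ∂P ≤
        4 * Real.exp 2 * momentConst a ^ 2 * K ^ 2 * h ^ (3 - a) := by
      -- Taking `lam = h⁻¹` gives the scaling `h ^ (3 - a)`; the factor `4` is `(2!)²`.
      have := (le_abs_self _).trans (abs_moment_squareIntegral_le hB hf hK hψ ha0 ha 2 hh.le hm
        (inv_pos.2 hh))
      refine this.trans (le_of_eq ?_)
      have e1 : ((h⁻¹) ^ ((a - 3) / 2)) ^ 2 = h ^ (3 - a) := by
        rw [← Real.rpow_natCast, ← Real.rpow_mul (by positivity), Real.inv_rpow hh.le,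
          ← Real.rpow_neg hh.le]
        congr 1; push_cast; ring
      rw [mul_pow, e1, mul_assoc 2, inv_mul_cancel₀ hh.ne']
      norm_num [Nat.factorial]
      ring
    have hi : ∀ {Y Z : Ω → ℝ} {c d : ℝ}, Measurable Y → Measurable Z → (∀ ω, |Y ω| ≤ c) →
        (∀ ω, |Z ω| ≤ d) → Integrable (fun ω => Y ω * Z ω) P := by
      intro Y Z c d hY hZ hc hd
      refine (integrable_const (c * d)).mono' (hY.mul hZ).aestronglyMeasurable
        (ae_of_all _ fun ω => ?_)
      rw [Real.norm_eq_abs, abs_mul]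
      exact mul_le_mul (hc ω) (hd ω) (abs_nonneg _) ((abs_nonneg _).trans (hc ω))
    have hcross : ∫ ω, rowSum B f h J ω * ξ ω ∂P = 0 := by
      have := hind.integral_fun_mul_eq_mul_integral hmr.aestronglyMeasurable
        hms.aestronglyMeasurable
      rw [this, h0, mul_zero]
    have hexp : ∀ ω, rowSum B f h (J + 1) ω ^ 2 =
        rowSum B f h J ω * rowSum B f h J ω + 2 * (rowSum B f h J ω * ξ ω) + ξ ω * ξ ω := by
      intro ω
      rw [rowSum_succ, Pi.add_apply]; ring
    simp_rw [hexp]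
    have hadd : Integrable (fun ω => rowSum B f h J ω * rowSum B f h J ω +
        2 * (rowSum B f h J ω * ξ ω)) P :=
      (hi hmr hmr hbr hbr).add ((hi hmr hms hbr hbs).const_mul 2)
    rw [integral_add hadd (hi hms hms hbs hbs),
      integral_add (hi hmr hmr hbr hbr) ((hi hmr hms hbr hbs).const_mul 2),
      integral_const_mul, hcross]
    simp_rw [← sq]
    push_cast
    linarith

end

/-! ### Dyadic decomposition of the triangle -/

/-- The triangle `a < s ≤ t ≤ a + h`. -/
def triangle (a h : ℝ) : Set (ℝ × ℝ) := {z | a < z.2 ∧ z.2 ≤ z.1 ∧ z.1 ≤ a + h}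

theorem measurableSet_triangle (a h : ℝ) : MeasurableSet (triangle a h) :=
  (measurableSet_lt measurable_const measurable_snd).inter
    ((measurableSet_le measurable_snd measurable_fst).inter
      (measurableSet_le measurable_fst measurable_const))

theorem triangle_subset (a h : ℝ) :
    triangle a h ⊆ Set.Ioc a (a + h) ×ˢ Set.Ioc a (a + h) := by
  rintro ⟨t, s⟩ ⟨h1, h2, h3⟩
  simp only [Set.mem_prod, Set.mem_Ioc] at *
  exact ⟨⟨by linarith, h3⟩, h1, by linarith⟩

theorem volume_triangle_le (a h : ℝ) :
    volume (triangle a h) ≤ ENNReal.ofReal h * ENNReal.ofReal h := by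
  refine (measure_mono (triangle_subset a h)).trans ?_
  rw [Measure.volume_eq_prod, Measure.prod_prod]
  simp

instance (a h : ℝ) : IsFiniteMeasure ((volume : Measure (ℝ × ℝ)).restrict (triangle a h)) := by
  constructor
  rw [Measure.restrict_apply_univ]
  exact (volume_triangle_le a h).trans_lt
    (ENNReal.mul_lt_top ENNReal.ofReal_lt_top ENNReal.ofReal_lt_top)

theorem abs_setIntegral_triangle_le {g : ℝ × ℝ → ℝ} {C : ℝ} (hg : ∀ z, |g z| ≤ C) {a h : ℝ}
    (hh : 0 ≤ h) : |∫ z in triangle a h, g z| ≤ C * h ^ 2 := by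
  have hC : 0 ≤ C := (abs_nonneg _).trans (hg 0)
  have := norm_setIntegral_le_of_norm_le_const (μ := volume) (s := triangle a h) (f := g) (C := C)
    (by rw [← Measure.restrict_apply_univ]; exact measure_lt_top _ _) fun z _ => hg z
  rw [Real.norm_eq_abs] at this
  refine this.trans (mul_le_mul_of_nonneg_left ?_ hC)
  have h1 := ENNReal.toReal_mono (ENNReal.mul_ne_top ENNReal.ofReal_ne_top ENNReal.ofReal_ne_top)
    (volume_triangle_le a h)
  simpa [ENNReal.toReal_mul, hh, sq, measureReal_def] using h1

theorem setIntegral_triangle_split {g : ℝ × ℝ → ℝ} (hm : Measurable g) {C : ℝ}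
    (hg : ∀ z, |g z| ≤ C) (a : ℝ) {h : ℝ} (_hh : 0 ≤ h) :
    ∫ z in triangle a (2 * h), g z = (∫ z in triangle a h, g z) + (∫ z in triangle (a + h) h, g z) +
      ∫ z in square (a + h) h, g z := by
  have e : triangle a (2 * h) = (triangle a h ∪ triangle (a + h) h) ∪ square (a + h) h := by
    ext ⟨t, s⟩
    simp only [triangle, square, Set.mem_union, Set.mem_prod, Set.mem_Ioc, Set.mem_ofPred_eq]
    constructor
    · rintro ⟨h1, h2, h3⟩
      by_cases c1 : t ≤ a + h
      · exact Or.inl (Or.inl ⟨h1, h2, c1⟩)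
      · push Not at c1
        by_cases c2 : s ≤ a + h
        · exact Or.inr ⟨⟨c1, by linarith⟩, by linarith, c2⟩
        · push Not at c2
          exact Or.inl (Or.inr ⟨c2, h2, by linarith⟩)
    · rintro ((⟨h1, h2, h3⟩ | ⟨h1, h2, h3⟩) | ⟨⟨h1, h2⟩, h3, h4⟩) <;>
        exact ⟨by linarith, by linarith, by linarith⟩
  have d1 : Disjoint (triangle a h) (triangle (a + h) h) := by
    rw [Set.disjoint_left]
    rintro ⟨t, s⟩ ⟨h1, h2, h3⟩ ⟨h4, h5, h6⟩
    simp only at *; linarith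
  have d2 : Disjoint (triangle a h ∪ triangle (a + h) h) (square (a + h) h) := by
    rw [Set.disjoint_left]
    rintro ⟨t, s⟩ (⟨h1, h2, h3⟩ | ⟨h1, h2, h3⟩) ⟨h4, h5⟩ <;>
      simp only [Set.mem_Ioc] at * <;> linarith
  have hi : ∀ s : Set (ℝ × ℝ), IsFiniteMeasure ((volume : Measure (ℝ × ℝ)).restrict s) →
      IntegrableOn g s := fun s hs =>
    (integrable_const C).mono' hm.aestronglyMeasurable (ae_of_all _ hg)
  rw [e, setIntegral_union d2 (measurableSet_square _ _) ((hi _ inferInstance).union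
    (hi _ inferInstance)) (hi _ inferInstance), setIntegral_union d1 (measurableSet_triangle _ _)
    (hi _ inferInstance) (hi _ inferInstance)]

theorem sum_range_two_mul (u : ℕ → ℝ) (J : ℕ) :
    ∑ j ∈ Finset.range (2 * J), u j = ∑ j ∈ Finset.range J, (u (2 * j) + u (2 * j + 1)) := by
  induction J with
  | zero => simp
  | succ J ih =>
    rw [Finset.sum_range_succ, ← ih, show 2 * (J + 1) = 2 * J + 1 + 1 by ring,
      Finset.sum_range_succ, Finset.sum_range_succ, add_assoc]

/-- Dyadic decomposition of the triangle into off-diagonal squares. -/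
theorem setIntegral_triangle_eq {g : ℝ × ℝ → ℝ} (hm : Measurable g) {C : ℝ}
    (hg : ∀ z, |g z| ≤ C) (K : ℕ) :
    ∫ z in triangle 0 1, g z =
      (∑ k ∈ Finset.range K, ∑ j ∈ Finset.range (2 ^ k),
        ∫ z in square ((2 * j + 1) * (1 / 2) ^ (k + 1)) ((1 / 2) ^ (k + 1)), g z) +
      ∑ j ∈ Finset.range (2 ^ K), ∫ z in triangle (j * (1 / 2) ^ K) ((1 / 2) ^ K), g z := by
  induction K with
  | zero => simp
  | succ K ih =>
    rw [ih, Finset.sum_range_succ, add_assoc, pow_succ' 2 K, sum_range_two_mul,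
      ← Finset.sum_add_distrib]
    congr 1
    refine Finset.sum_congr rfl fun j _ => ?_
    have := setIntegral_triangle_split hm hg (j * (1 / 2) ^ K) (h := (1 / 2) ^ (K + 1))
      (by positivity)
    rw [show (2 : ℝ) * (1 / 2) ^ (K + 1) = (1 / 2) ^ K by rw [pow_succ]; ring] at this
    rw [this]
    have e1 : (j : ℝ) * (1 / 2) ^ K + (1 / 2) ^ (K + 1) = (2 * j + 1) * (1 / 2) ^ (K + 1) := by
      rw [pow_succ]; ring
    have e2 : (j : ℝ) * (1 / 2) ^ K = ((2 * j : ℕ) : ℝ) * (1 / 2) ^ (K + 1) := by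
      rw [pow_succ]; push_cast; ring
    rw [e1, e2]
    push_cast
    ring

/-- The regularised functional over the triangle. -/
noncomputable def triangleIntegral {Ω : Type*} (B : ℝ≥0 → Ω → ℝ) (f : ℝ → ℝ) (ω : Ω) : ℝ :=
  ∫ z in triangle 0 1, f (incr B z ω)

/-! ### Exponential and first moments over the whole triangle -/

section
variable {Ω : Type*} [MeasurableSpace Ω] {P : Measure Ω} {B : ℝ≥0 → Ω → ℝ}

theorem measurable_triangleIntegral (hB : IsContinuousBrownian B P) {f : ℝ → ℝ}
    (hf : Measurable f) : Measurable (triangleIntegral B f) := by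
  have h1 : Measurable fun q : Ω × (ℝ × ℝ) => f (incr B q.2 q.1) :=
    hf.comp (hB.measurable_incr.comp measurable_swap)
  exact (h1.stronglyMeasurable.integral_prod_right'
    (ν := volume.restrict (triangle 0 1))).measurable

theorem abs_triangleIntegral_le {Ω : Type*} {B : ℝ≥0 → Ω → ℝ} {f : ℝ → ℝ} {C : ℝ}
    (hf : ∀ x, |f x| ≤ C) (ω : Ω) : |triangleIntegral B f ω| ≤ C := by
  have := abs_setIntegral_triangle_le (a := 0) (fun z => hf (incr B z ω)) zero_le_one
  rwa [one_pow, mul_one] at this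

/-- The sum of the contributions of the squares of the `k`-th dyadic generation. -/
noncomputable def levelSum {Ω : Type*} (B : ℝ≥0 → Ω → ℝ) (f : ℝ → ℝ) (k : ℕ) : Ω → ℝ :=
  rowSum B f ((1 / 2) ^ (k + 1)) (2 ^ k)

/-- What remains after `K` generations is `2 ^ K` triangles of area at most `4 ^ (-K)`. The sup
bound `C` may blow up with the regularisation, but it is only used for fixed `f` as `K → ∞`. -/
theorem abs_triangleIntegral_sub_le (hB : IsContinuousBrownian B P) {f : ℝ → ℝ}
    (hf : Continuous f) {C : ℝ} (hC : ∀ x, |f x| ≤ C) (K : ℕ) (ω : Ω) :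
    |triangleIntegral B f ω - ∑ k ∈ Finset.range K, levelSum B f k ω| ≤ C * (1 / 2) ^ K := by
  have hm : Measurable fun z => f (incr B z ω) :=
    hf.measurable.comp (hB.measurable_incr.comp measurable_prodMk_right)
  have h1 := setIntegral_triangle_eq hm (fun z => hC (incr B z ω)) K
  have h2 : triangleIntegral B f ω - ∑ k ∈ Finset.range K, levelSum B f k ω =
      ∑ j ∈ Finset.range (2 ^ K), ∫ z in triangle (j * (1 / 2) ^ K) ((1 / 2) ^ K),
        f (incr B z ω) := by
    unfold triangleIntegral levelSum rowSum squareIntegral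
    rw [h1]; ring
  rw [h2]
  refine (Finset.abs_sum_le_sum_abs _ _).trans ((Finset.sum_le_sum fun j _ =>
    abs_setIntegral_triangle_le (fun z => hC (incr B z ω)) (by positivity)).trans (le_of_eq ?_))
  rw [Finset.sum_const, Finset.card_range, nsmul_eq_mul]
  push_cast
  have : (2 : ℝ) ^ K * (1 / 2) ^ K = 1 := by rw [← mul_pow]; norm_num
  linear_combination (C * (1 / 2) ^ K) * this

/-- The room for growth of `l` comes from independence: with rate `4/3` the exponent of one square
is of order `(2/3) ^ (2k)`, and `2 * (2/3)² = 8/9 < 1`, so all `2 ^ k` squares together stay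
bounded. -/
theorem mgf_levelSum_le [IsProbabilityMeasure P] (hB : IsContinuousBrownian B P)
    {f : ℝ → ℝ} {ψ : ℝ → ℂ} (hf : IsFourier f ψ) (hodd : ∀ x, f (-x) = -f x) {K : ℝ}
    (hK : 0 ≤ K) (hψ : ∀ p, ‖ψ p‖ ≤ K * |p|) (k : ℕ) {l : ℝ}
    (hl : |l| * (K * expConst) ≤ (4 / 3) ^ k) :
    mgf (levelSum B f k) P l ≤ Real.exp (1 / 2) := by
  have hA : 0 ≤ K * expConst := by
    have := momentConst_nonneg 1
    unfold expConst; positivity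
  have h0 : |l| * (K * expConst * (1 / 2) ^ (k + 1)) ≤ (2 / 3) ^ k / 2 := by
    calc _ = |l| * (K * expConst) * (1 / 2) ^ (k + 1) := by ring
      _ ≤ (4 / 3) ^ k * (1 / 2) ^ (k + 1) := by gcongr
      _ = _ := by rw [pow_succ, ← mul_assoc, ← mul_pow]; norm_num; ring
  have h1 : ((2 : ℝ) / 3) ^ k ≤ 1 := pow_le_one₀ (by norm_num) (by norm_num)
  refine (mgf_rowSum_le hB hf hodd hK hψ (by positivity) (h0.trans (by linarith)) _).trans ?_
  rw [← Real.exp_nat_mul, Real.exp_le_exp]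
  push_cast
  calc (2 : ℝ) ^ k * (2 * (|l| * (K * expConst * (1 / 2) ^ (k + 1))) ^ 2)
      ≤ 2 ^ k * (2 * ((2 / 3) ^ k / 2) ^ 2) := by gcongr
    _ = (8 / 9) ^ k / 2 := by
      rw [div_pow, ← pow_mul, mul_comm k 2, pow_mul,
        show ((8 : ℝ) / 9) ^ k = 2 ^ k * ((2 / 3) ^ 2) ^ k by rw [← mul_pow]; norm_num]
      ring
    _ ≤ 1 / 2 := by
      have : ((8 : ℝ) / 9) ^ k ≤ 1 := pow_le_one₀ (by norm_num) (by norm_num)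
      linarith

/-- The generations are not independent of each other, so Jensen is used with weights `(3/4) ^ k /
W`. This multiplies the parameter of generation `k` by `W * (4/3) ^ k`, and `W ≤ 4` explains the `4`
in `hc`. -/
theorem integral_exp_sum_levelSum_le [IsProbabilityMeasure P] (hB : IsContinuousBrownian B P)
    {f : ℝ → ℝ} {ψ : ℝ → ℂ} (hf : IsFourier f ψ) (hodd : ∀ x, f (-x) = -f x) {K : ℝ}
    (hK : 0 ≤ K) (hψ : ∀ p, ‖ψ p‖ ≤ K * |p|) {c : ℝ} (hc : 4 * |c| * (K * expConst) ≤ 1)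
    (N : ℕ) :
    ∫ ω, Real.exp (c * ∑ k ∈ Finset.range (N + 1), levelSum B f k ω) ∂P ≤ Real.exp (1 / 2) := by
  have hA : 0 ≤ K * expConst := by
    have := momentConst_nonneg 1
    unfold expConst; positivity
  set W : ℝ := ∑ k ∈ Finset.range (N + 1), (3 / 4 : ℝ) ^ k with hW
  have hWpos : 0 < W := Finset.sum_pos (fun _ _ => by positivity) (by simp)
  have hW4 : W ≤ 4 := by
    have := geom_sum_eq (x := (3 / 4 : ℝ)) (by norm_num) (N + 1)
    rw [hW, this]
    have : (0 : ℝ) ≤ (3 / 4) ^ (N + 1) := by positivity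
    rw [div_le_iff_of_neg (by norm_num)]; linarith
  let l : ℕ → ℝ := fun k => c * W * (4 / 3) ^ k
  have hw : ∀ k : ℕ, (3 / 4 : ℝ) ^ k * (4 / 3) ^ k = 1 := fun k => by rw [← mul_pow]; norm_num
  have hint : ∀ k, Integrable (fun ω => Real.exp (l k * levelSum B f k ω)) P := by
    intro k
    have hm : Measurable (levelSum B f k) := measurable_rowSum hB hf.continuous _ _
    refine (integrable_const (Real.exp (|l k| * (((2 ^ k : ℕ) : ℝ) *
      ((∫ p, ‖ψ p‖) * ((1 / 2) ^ (k + 1)) ^ 2))))).mono'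
      (by fun_prop : Measurable _).aestronglyMeasurable (ae_of_all _ fun ω => ?_)
    rw [Real.norm_of_nonneg (Real.exp_pos _).le, Real.exp_le_exp]
    refine (le_abs_self _).trans ?_
    rw [abs_mul]
    exact mul_le_mul_of_nonneg_left (abs_rowSum_le hf.abs_le (by positivity) _ ω) (abs_nonneg _)
  have hJ : ∀ ω, Real.exp (c * ∑ k ∈ Finset.range (N + 1), levelSum B f k ω) ≤
      ∑ k ∈ Finset.range (N + 1), ((3 / 4 : ℝ) ^ k / W) * Real.exp (l k * levelSum B f k ω) := by
    intro ω
    have := convexOn_exp.map_sum_le (t := Finset.range (N + 1))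
      (w := fun k => (3 / 4 : ℝ) ^ k / W) (p := fun k => l k * levelSum B f k ω)
      (fun k _ => by positivity) (by rw [← Finset.sum_div, div_self hWpos.ne'])
      (fun k _ => Set.mem_univ _)
    simp only [smul_eq_mul] at this
    refine le_trans (le_of_eq ?_) this
    rw [Finset.mul_sum]
    congr 1
    refine Finset.sum_congr rfl fun k _ => ?_
    simp only [l]
    field_simp
    linear_combination (-c * levelSum B f k ω) * hw k
  refine (integral_mono_of_nonneg (ae_of_all _ fun _ => (Real.exp_pos _).le)
    (integrable_finsetSum _ fun k _ => (hint k).const_mul _) (ae_of_all _ hJ)).trans ?_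
  rw [integral_finsetSum _ fun k _ => (hint k).const_mul _]
  have hk : ∀ k ∈ Finset.range (N + 1),
      ∫ ω, ((3 / 4 : ℝ) ^ k / W) * Real.exp (l k * levelSum B f k ω) ∂P ≤
        ((3 / 4 : ℝ) ^ k / W) * Real.exp (1 / 2) := by
    intro k _
    rw [integral_const_mul]
    refine mul_le_mul_of_nonneg_left (mgf_levelSum_le hB hf hodd hK hψ k ?_) (by positivity)
    simp only [l]
    rw [abs_mul, abs_mul, abs_of_pos hWpos, abs_of_pos (by positivity : (0 : ℝ) < (4 / 3) ^ k)]
    calc |c| * W * (4 / 3) ^ k * (K * expConst) ≤ |c| * 4 * (4 / 3) ^ k * (K * expConst) := by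
          gcongr
      _ = 4 * |c| * (K * expConst) * (4 / 3) ^ k := by ring
      _ ≤ 1 * (4 / 3) ^ k := by gcongr
      _ = _ := one_mul _
  refine (Finset.sum_le_sum hk).trans (le_of_eq ?_)
  rw [← Finset.sum_mul, ← Finset.sum_div, div_self hWpos.ne', one_mul]

theorem tendsto_exp_geometric (c C : ℝ) :
    Tendsto (fun N : ℕ => Real.exp (c * (C * (1 / 2) ^ (N + 1)))) atTop (𝓝 1) := by
  have h1 : Tendsto (fun N : ℕ => ((1 : ℝ) / 2) ^ (N + 1)) atTop (𝓝 0) :=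
    (tendsto_pow_atTop_nhds_zero_of_lt_one (by norm_num) (by norm_num)).comp
      (tendsto_add_atTop_nat 1)
  have h2 := (Real.continuous_exp.tendsto _).comp ((h1.const_mul C).const_mul c)
  simpa [Function.comp_def] using h2

/-- The truncation error is uniformly small on `Ω` and disappears as `N → ∞`, so the final bound
depends on `ψ` only through `K`. -/
theorem integral_exp_triangleIntegral_le [IsProbabilityMeasure P] (hB : IsContinuousBrownian B P)
    {f : ℝ → ℝ} {ψ : ℝ → ℂ} (hf : IsFourier f ψ) (hodd : ∀ x, f (-x) = -f x) {K : ℝ}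
    (hK : 0 ≤ K) (hψ : ∀ p, ‖ψ p‖ ≤ K * |p|) {c : ℝ} (hc : 4 * |c| * (K * expConst) ≤ 1) :
    ∫ ω, Real.exp (c * triangleIntegral B f ω) ∂P ≤ Real.exp (1 / 2) := by
  set C := ∫ p, ‖ψ p‖
  have hm : ∀ k, Measurable (levelSum B f k) := fun k => measurable_rowSum hB hf.continuous _ _
  have key : ∀ N : ℕ, ∫ ω, Real.exp (c * triangleIntegral B f ω) ∂P ≤
      Real.exp (|c| * (C * (1 / 2) ^ (N + 1))) * Real.exp (1 / 2) := by
    intro N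
    have hsub := abs_triangleIntegral_sub_le hB hf.continuous hf.abs_le (N + 1)
    have hb : ∀ ω, |∑ k ∈ Finset.range (N + 1), levelSum B f k ω| ≤
        C + C * (1 / 2) ^ (N + 1) := fun ω => by
      have h1 := abs_le.1 (hsub ω)
      have h2 := abs_le.1 (abs_triangleIntegral_le (B := B) hf.abs_le ω)
      rw [abs_le]; constructor <;> linarith [h1.1, h1.2, h2.1, h2.2]
    refine (integral_mono_of_nonneg (ae_of_all _ fun _ => (Real.exp_pos _).le)
      (Integrable.const_mul ?_ _) (ae_of_all _ fun ω => ?_)).trans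
        ((integral_const_mul _ _).le.trans (mul_le_mul_of_nonneg_left
          (integral_exp_sum_levelSum_le hB hf hodd hK hψ hc N) (Real.exp_pos _).le))
    · refine (integrable_const (Real.exp (|c| * (C + C * (1 / 2) ^ (N + 1))))).mono'
        (by fun_prop : Measurable _).aestronglyMeasurable (ae_of_all _ fun ω => ?_)
      rw [Real.norm_of_nonneg (Real.exp_pos _).le, Real.exp_le_exp]
      refine (le_abs_self _).trans ?_
      rw [abs_mul]
      exact mul_le_mul_of_nonneg_left (hb ω) (abs_nonneg _)
    · simp only
      rw [← Real.exp_add, Real.exp_le_exp]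
      have : c * (triangleIntegral B f ω - ∑ k ∈ Finset.range (N + 1), levelSum B f k ω) ≤
          |c| * (C * (1 / 2) ^ (N + 1)) := by
        refine (le_abs_self _).trans ?_
        rw [abs_mul]
        exact mul_le_mul_of_nonneg_left (hsub ω) (abs_nonneg _)
      linarith
  have := (tendsto_exp_geometric |c| C).mul_const (Real.exp (1 / 2))
  rw [one_mul] at this
  exact ge_of_tendsto' this key

/-- The constant in the first moment bound. -/
noncomputable def firstMomentConst : ℝ := 10 * Real.exp 1 * momentConst (5 / 4)

theorem integral_abs_levelSum_le [IsProbabilityMeasure P] (hB : IsContinuousBrownian B P)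
    {f : ℝ → ℝ} {ψ : ℝ → ℂ} (hf : IsFourier f ψ) (hodd : ∀ x, f (-x) = -f x) {K : ℝ}
    (hK : 0 ≤ K) (hψ : ∀ p, ‖ψ p‖ ≤ K * |p| ^ (5 / 4 : ℝ)) (k : ℕ) :
    ∫ ω, |levelSum B f k ω| ∂P ≤ 2 * Real.exp 1 * momentConst (5 / 4) * K * (4 / 5) ^ k := by
  have hm : Measurable (levelSum B f k) := measurable_rowSum hB hf.continuous _ _
  have hc := momentConst_nonneg (5 / 4)
  have h1 : ∫ ω, levelSum B f k ω ^ 2 ∂P ≤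
      (2 * Real.exp 1 * momentConst (5 / 4) * K * (4 / 5) ^ k) ^ 2 := by
    refine (integral_rowSum_sq_le hB hf hodd hK hψ (by norm_num) (by norm_num) (by positivity)
      _).trans ?_
    -- Here `2 ^ (-7/4) ≤ 8/25`, and `2 * (8/25) = (4/5)²` is the decay rate of the second moment of
    -- a generation.
    have e1 : ((1 / 2 : ℝ) ^ (k + 1)) ^ (3 - 5 / 4 : ℝ) ≤ (8 / 25) ^ (k + 1) := by
      rw [← Real.rpow_natCast, ← Real.rpow_mul (by norm_num), mul_comm, Real.rpow_mul (by norm_num),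
        Real.rpow_natCast]
      refine pow_le_pow_left₀ (by positivity) ?_ _
      refine le_of_pow_le_pow_left₀ (n := 4) (by norm_num) (by norm_num) ?_
      rw [← Real.rpow_natCast, ← Real.rpow_mul (by norm_num)]
      norm_num
    push_cast
    calc (2 : ℝ) ^ k * (4 * Real.exp 2 * momentConst (5 / 4) ^ 2 * K ^ 2 *
          ((1 / 2) ^ (k + 1)) ^ (3 - 5 / 4 : ℝ))
        ≤ 2 ^ k * (4 * Real.exp 2 * momentConst (5 / 4) ^ 2 * K ^ 2 * (8 / 25) ^ (k + 1)) := by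
          gcongr
      _ ≤ 2 ^ k * (4 * Real.exp 2 * momentConst (5 / 4) ^ 2 * K ^ 2 * (8 / 25) ^ k) := by
          gcongr 2 ^ k * (_ * ?_)
          exact pow_le_pow_of_le_one (by norm_num) (by norm_num) (Nat.le_succ k)
      _ = 4 * Real.exp 1 ^ 2 * momentConst (5 / 4) ^ 2 * K ^ 2 * ((4 / 5) ^ k) ^ 2 := by
          have e2 : Real.exp 2 = Real.exp 1 ^ 2 := by rw [← Real.exp_nat_mul]; norm_num
          have e3 : (((4 : ℝ) / 5) ^ k) ^ 2 = 2 ^ k * (8 / 25) ^ k := by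
            rw [← pow_mul, mul_comm k 2, pow_mul, ← mul_pow]; norm_num
          rw [e2, e3]; ring
      _ = _ := by ring
  have hL : MemLp (levelSum B f k) 2 P :=
    MemLp.of_bound hm.aestronglyMeasurable _ (ae_of_all _ fun ω =>
      abs_rowSum_le hf.abs_le (by positivity) _ ω)
  have h2 : (∫ ω, |levelSum B f k ω| ∂P) ^ 2 ≤ ∫ ω, levelSum B f k ω ^ 2 ∂P := by
    have := variance_nonneg (fun ω => |levelSum B f k ω|) P
    rw [variance_eq_sub (show MemLp (fun ω => |levelSum B f k ω|) 2 P from hL.abs)] at this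
    simp only [Pi.pow_apply, sq_abs] at this
    linarith
  exact le_of_pow_le_pow_left₀ two_ne_zero (by positivity) (h2.trans h1)

theorem integral_abs_triangleIntegral_le [IsProbabilityMeasure P] (hB : IsContinuousBrownian B P)
    {f : ℝ → ℝ} {ψ : ℝ → ℂ} (hf : IsFourier f ψ) (hodd : ∀ x, f (-x) = -f x) {K : ℝ}
    (hK : 0 ≤ K) (hψ : ∀ p, ‖ψ p‖ ≤ K * |p| ^ (5 / 4 : ℝ)) :
    ∫ ω, |triangleIntegral B f ω| ∂P ≤ firstMomentConst * K := by
  set C := ∫ p, ‖ψ p‖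
  have hc := momentConst_nonneg (5 / 4)
  have hint : ∀ k, Integrable (fun ω => |levelSum B f k ω|) P := fun k =>
    (MemLp.of_bound (p := 1) (measurable_rowSum hB hf.continuous _ _).aestronglyMeasurable _
      (ae_of_all _ fun ω => abs_rowSum_le hf.abs_le (by positivity) _ ω)).integrable le_rfl |>.abs
  have key : ∀ N : ℕ, ∫ ω, |triangleIntegral B f ω| ∂P ≤
      C * (1 / 2) ^ N + firstMomentConst * K := by
    intro N
    have hle : ∀ ω, |triangleIntegral B f ω| ≤
        C * (1 / 2) ^ N + ∑ k ∈ Finset.range N, |levelSum B f k ω| := by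
      intro ω
      have h1 := abs_triangleIntegral_sub_le hB hf.continuous hf.abs_le N ω
      have h2 := Finset.abs_sum_le_sum_abs (fun k => levelSum B f k ω) (Finset.range N)
      have h3 := abs_sub_abs_le_abs_sub (triangleIntegral B f ω)
        (∑ k ∈ Finset.range N, levelSum B f k ω)
      linarith
    refine (integral_mono_of_nonneg (ae_of_all _ fun _ => abs_nonneg _)
      ((integrable_const _).add (integrable_finsetSum _ fun k _ => hint k))
      (ae_of_all _ hle)).trans ?_
    simp only [Pi.add_apply]
    rw [integral_add (integrable_const _) (integrable_finsetSum _ fun k _ => hint k),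
      integral_finsetSum _ fun k _ => hint k]
    simp only [integral_const, probReal_univ, one_smul]
    refine add_le_add le_rfl ((Finset.sum_le_sum fun k _ =>
      integral_abs_levelSum_le hB hf hodd hK hψ k).trans ?_)
    rw [← Finset.mul_sum]
    have hg : ∑ k ∈ Finset.range N, (4 / 5 : ℝ) ^ k ≤ 5 := by
      rw [geom_sum_eq (by norm_num) N]
      have : (0 : ℝ) ≤ (4 / 5) ^ N := by positivity
      rw [div_le_iff_of_neg (by norm_num)]; linarith
    unfold firstMomentConst
    calc _ ≤ 2 * Real.exp 1 * momentConst (5 / 4) * K * 5 := by gcongr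
      _ = _ := by ring
  have h1 : Tendsto (fun N : ℕ => C * ((1 : ℝ) / 2) ^ N + firstMomentConst * K) atTop
      (𝓝 (C * 0 + firstMomentConst * K)) :=
    ((tendsto_pow_atTop_nhds_zero_of_lt_one (by norm_num) (by norm_num)).const_mul C).add_const _
  rw [mul_zero, zero_add] at h1
  exact ge_of_tendsto' h1 key

end

/-! ### The derivative of the heat kernel in frequency variables -/

/-- The Fourier transform of an integrable Hermitian function is real. -/
theorem isFourier_re {ψ : ℝ → ℂ} (hi : Integrable ψ)
    (hconj : ∀ p, ψ (-p) = (starRingEnd ℂ) (ψ p)) :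
    IsFourier (fun x => (∫ p, ψ p * Complex.exp (Complex.I * (p * x : ℝ))).re) ψ := by
  refine ⟨hi, fun x => ?_⟩
  rw [← Complex.conj_eq_iff_re, ← integral_conj, ← integral_neg_eq_self]
  refine integral_congr_ae (ae_of_all _ fun p => ?_)
  simp only [map_mul, hconj, Complex.conj_conj, ← Complex.exp_conj, Complex.conj_I,
    Complex.conj_ofReal]
  congr 2
  push_cast; ring

theorem IsFourier.odd {f : ℝ → ℝ} {ψ : ℝ → ℂ} (h : IsFourier f ψ) (hodd : ∀ p, ψ (-p) = -ψ p)
    (x : ℝ) : f (-x) = -f x := by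
  have : (f (-x) : ℂ) = -(f x : ℂ) := by
    rw [h.eq, h.eq, ← integral_neg_eq_self, ← integral_neg]
    refine integral_congr_ae (ae_of_all _ fun p => ?_)
    simp [hodd]
  exact_mod_cast this

/-- The frequency density of the derivative of the heat kernel at time `v`. -/
noncomputable def heatFreq (v p : ℝ) : ℂ :=
  Complex.I / (2 * (Real.pi : ℂ)) * p * (Real.exp (-(p ^ 2 * v / 2)) : ℝ)

/-- The time derivative of `heatFreq`. -/
noncomputable def heatFreqDeriv (v p : ℝ) : ℂ := -(p ^ 2 / 2 : ℝ) * heatFreq v p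

noncomputable def heatDeriv (v x : ℝ) : ℝ :=
  (∫ p, heatFreq v p * Complex.exp (Complex.I * (p * x : ℝ))).re

noncomputable def heatTimeDeriv (v x : ℝ) : ℝ :=
  (∫ p, heatFreqDeriv v p * Complex.exp (Complex.I * (p * x : ℝ))).re

theorem continuous_heatFreq : Continuous fun q : ℝ × ℝ => heatFreq q.1 q.2 := by
  unfold heatFreq; fun_prop

theorem continuous_heatFreqDeriv : Continuous fun q : ℝ × ℝ => heatFreqDeriv q.1 q.2 :=
  Continuous.mul (by fun_prop) continuous_heatFreq

theorem norm_heatFreq (v p : ℝ) :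
    ‖heatFreq v p‖ = (2 * Real.pi)⁻¹ * (|p| * Real.exp (-(p ^ 2 * v / 2))) := by
  unfold heatFreq
  rw [norm_mul, norm_mul, norm_div, Complex.norm_I, norm_mul, Complex.norm_real, Complex.norm_real,
    Complex.norm_real, Real.norm_of_nonneg (Real.exp_pos _).le, Real.norm_of_nonneg Real.pi_pos.le,
    Real.norm_eq_abs]
  simp
  ring

theorem norm_heatFreqDeriv (v p : ℝ) :
    ‖heatFreqDeriv v p‖ = (4 * Real.pi)⁻¹ * (|p| ^ 3 * Real.exp (-(p ^ 2 * v / 2))) := by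
  unfold heatFreqDeriv
  rw [norm_mul, norm_heatFreq, norm_neg, Complex.norm_real, Real.norm_of_nonneg (by positivity),
    ← sq_abs p]
  have := Real.pi_pos
  field_simp
  norm_num

theorem inv_two_pi_le : (2 * Real.pi)⁻¹ ≤ 1 / 2 := by
  rw [inv_le_comm₀ (by positivity) (by norm_num)]
  linarith [Real.pi_gt_three]

theorem inv_four_pi_le : (4 * Real.pi)⁻¹ ≤ 1 / 2 := by
  rw [inv_le_comm₀ (by positivity) (by norm_num)]
  linarith [Real.pi_gt_three]

theorem integrable_abs_pow_mul_exp {v : ℝ} (hv : 0 < v) (n : ℕ) :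
    Integrable fun p : ℝ => |p| ^ n * Real.exp (-(p ^ 2 * v / 2)) := by
  have h := (integrable_rpow_mul_exp_neg_mul_sq (b := v / 2) (by positivity) (s := n)
    (by have := Nat.cast_nonneg (α := ℝ) n; linarith)).norm
  refine h.congr (ae_of_all _ fun p => ?_)
  simp only [Real.rpow_natCast, norm_mul, norm_pow, Real.norm_eq_abs, Real.abs_exp]
  congr 2; ring

theorem integrable_heatFreq {v : ℝ} (hv : 0 < v) : Integrable (heatFreq v) := by
  refine ((integrable_abs_pow_mul_exp hv 1).const_mul (2 * Real.pi)⁻¹).mono'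
    (continuous_heatFreq.comp (by fun_prop : Continuous fun p => (v, p))).aestronglyMeasurable
    (ae_of_all _ fun p => ?_)
  rw [norm_heatFreq, pow_one]

theorem integrable_heatFreqDeriv {v : ℝ} (hv : 0 < v) : Integrable (heatFreqDeriv v) := by
  refine ((integrable_abs_pow_mul_exp hv 3).const_mul (4 * Real.pi)⁻¹).mono'
    (continuous_heatFreqDeriv.comp
      (by fun_prop : Continuous fun p => (v, p))).aestronglyMeasurable
    (ae_of_all _ fun p => ?_)
  rw [norm_heatFreqDeriv]

theorem heatFreq_neg (v p : ℝ) : heatFreq v (-p) = -heatFreq v p := by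
  simp [heatFreq]

theorem heatFreqDeriv_neg (v p : ℝ) : heatFreqDeriv v (-p) = -heatFreqDeriv v p := by
  simp [heatFreqDeriv, heatFreq_neg]

theorem conj_heatFreq (v p : ℝ) : (starRingEnd ℂ) (heatFreq v p) = -heatFreq v p := by
  unfold heatFreq
  simp only [map_mul, map_div₀, Complex.conj_I, Complex.conj_ofReal, map_ofNat]
  ring

theorem isFourier_heatDeriv {v : ℝ} (hv : 0 < v) : IsFourier (heatDeriv v) (heatFreq v) :=
  isFourier_re (integrable_heatFreq hv) fun p => by rw [heatFreq_neg, conj_heatFreq]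

theorem isFourier_heatTimeDeriv {v : ℝ} (hv : 0 < v) :
    IsFourier (heatTimeDeriv v) (heatFreqDeriv v) :=
  isFourier_re (integrable_heatFreqDeriv hv) fun p => by
    rw [heatFreqDeriv_neg]
    unfold heatFreqDeriv
    rw [map_mul, conj_heatFreq, map_neg, Complex.conj_ofReal]
    ring

/-- The bound does not involve `v`; this makes the exponential moments uniform in the
regularisation. -/
theorem norm_heatFreq_le {v : ℝ} (hv : 0 < v) (p : ℝ) : ‖heatFreq v p‖ ≤ 1 * |p| := by
  rw [norm_heatFreq]
  have h1 : Real.exp (-(p ^ 2 * v / 2)) ≤ 1 := Real.exp_le_one_iff.2 (by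
    have : 0 ≤ p ^ 2 * v / 2 := by positivity
    linarith)
  exact mul_le_mul (inv_two_pi_le.trans (by norm_num))
    (mul_le_of_le_one_right (abs_nonneg p) h1) (by positivity) zero_le_one

theorem rpow_mul_exp_le {y : ℝ} (hy : 0 ≤ y) : y ^ (7 / 8 : ℝ) * Real.exp (-(y / 2)) ≤ 2 := by
  have h1 : y ^ (7 / 8 : ℝ) ≤ 1 + y := by
    rcases le_total y 1 with h | h
    · exact (Real.rpow_le_one hy h (by norm_num)).trans (by linarith)
    · exact (Real.rpow_le_rpow_of_exponent_le h (by norm_num : (7 / 8 : ℝ) ≤ 1)).trans (by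
        rw [Real.rpow_one]; linarith)
  have h2 := Real.add_one_le_exp (y / 2)
  rw [Real.exp_neg, ← div_eq_mul_inv, div_le_iff₀ (Real.exp_pos _)]
  linarith

/-- The cubic growth is split as `3 = 5/4 + 2 * (7/8)`, and the Gaussian pays for the second part.
Both exponents are admissible: `5/4 < 3/2` for the moment bounds, and `7/8 < 1` for integrability in
`v` at `0`. -/
theorem norm_heatFreqDeriv_le {v : ℝ} (hv : 0 < v) (p : ℝ) :
    ‖heatFreqDeriv v p‖ ≤ v ^ (-(7 / 8) : ℝ) * |p| ^ (5 / 4 : ℝ) := by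
  rw [norm_heatFreqDeriv]
  have h1 := rpow_mul_exp_le (y := p ^ 2 * v) (by positivity)
  have h2 : |p| ^ 3 = v ^ (-(7 / 8) : ℝ) * |p| ^ (5 / 4 : ℝ) * (p ^ 2 * v) ^ (7 / 8 : ℝ) := by
    have e1 : v ^ (-(7 / 8) : ℝ) * v ^ (7 / 8 : ℝ) = 1 := by
      rw [← Real.rpow_add hv]; norm_num
    have e2 : |p| ^ (5 / 4 : ℝ) * (p ^ 2) ^ (7 / 8 : ℝ) = |p| ^ 3 := by
      rw [← sq_abs, ← Real.rpow_natCast, ← Real.rpow_natCast, ← Real.rpow_mul (abs_nonneg p),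
        ← Real.rpow_add_of_nonneg (abs_nonneg p) (by norm_num) (by norm_num)]
      norm_num
    rw [Real.mul_rpow (by positivity) hv.le]
    linear_combination (-|p| ^ (5 / 4 : ℝ) * (p ^ 2) ^ (7 / 8 : ℝ)) * e1 - e2
  rw [h2]
  have h3 : 0 ≤ v ^ (-(7 / 8) : ℝ) * |p| ^ (5 / 4 : ℝ) := by positivity
  calc _ = (4 * Real.pi)⁻¹ * ((v ^ (-(7 / 8) : ℝ) * |p| ^ (5 / 4 : ℝ)) *
        ((p ^ 2 * v) ^ (7 / 8 : ℝ) * Real.exp (-(p ^ 2 * v / 2)))) := by ring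
    _ ≤ 1 / 2 * ((v ^ (-(7 / 8) : ℝ) * |p| ^ (5 / 4 : ℝ)) * 2) := by
        have := inv_four_pi_le
        gcongr
    _ = _ := by ring

theorem measurable_heatTimeDeriv : Measurable fun q : ℝ × ℝ => heatTimeDeriv q.1 q.2 := by
  have h : Continuous fun r : (ℝ × ℝ) × ℝ =>
      heatFreqDeriv r.1.1 r.2 * Complex.exp (Complex.I * (r.2 * r.1.2 : ℝ)) :=
    (continuous_heatFreqDeriv.comp
      (by fun_prop : Continuous fun r : (ℝ × ℝ) × ℝ => (r.1.1, r.2))).mul (by fun_prop)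
  exact Complex.measurable_re.comp h.stronglyMeasurable.integral_prod_right'.measurable

theorem measurable_heatTimeDeriv_comp {α : Type*} [MeasurableSpace α] {f g : α → ℝ}
    (hf : Measurable f) (hg : Measurable g) : Measurable fun a => heatTimeDeriv (f a) (g a) := by
  have h := Measurable.comp measurable_heatTimeDeriv (hf.prodMk hg)
  simpa only [Function.comp_def] using h

/-- A bound on the time derivative, uniform over times bounded away from `0`. -/
noncomputable def heatTimeBound (η : ℝ) : ℝ :=
  ∫ p : ℝ, (4 * Real.pi)⁻¹ * (|p| ^ 3 * Real.exp (-(p ^ 2 * η / 2)))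

theorem norm_heatFreqDeriv_anti {η v : ℝ} (h : η ≤ v) (p : ℝ) :
    ‖heatFreqDeriv v p‖ ≤ (4 * Real.pi)⁻¹ * (|p| ^ 3 * Real.exp (-(p ^ 2 * η / 2))) := by
  rw [norm_heatFreqDeriv]
  have := Real.pi_pos
  gcongr

theorem abs_heatTimeDeriv_le {η v : ℝ} (hη : 0 < η) (h : η ≤ v) (x : ℝ) :
    |heatTimeDeriv v x| ≤ heatTimeBound η :=
  ((isFourier_heatTimeDeriv (hη.trans_le h)).abs_le x).trans
    (integral_mono (integrable_heatFreqDeriv (hη.trans_le h)).norm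
      ((integrable_abs_pow_mul_exp hη 3).const_mul _) fun p => norm_heatFreqDeriv_anti h p)

theorem hasDerivAt_heatDeriv {v : ℝ} (hv : 0 < v) (x : ℝ) :
    HasDerivAt (fun v => heatDeriv v x) (heatTimeDeriv v x) v := by
  have hm : ∀ w, AEStronglyMeasurable
      (fun p => heatFreq w p * Complex.exp (Complex.I * (p * x : ℝ))) := fun w =>
    ((continuous_heatFreq.comp (by fun_prop : Continuous fun p => (w, p))).mul
      (by fun_prop)).aestronglyMeasurable
  have hd : ∀ w p, HasDerivAt (fun w => heatFreq w p) (heatFreqDeriv w p) w := by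
    intro w p
    have h1 : HasDerivAt (fun w : ℝ => Real.exp (-(p ^ 2 * w / 2)))
        (Real.exp (-(p ^ 2 * w / 2)) * -(p ^ 2 * 1 / 2)) w :=
      (((hasDerivAt_id w).const_mul (p ^ 2)).div_const 2).neg.exp
    have h2 := h1.ofReal_comp.const_mul (Complex.I / (2 * (Real.pi : ℂ)) * p)
    refine h2.congr_deriv ?_
    unfold heatFreqDeriv heatFreq
    push_cast
    ring
  have h := (hasDerivAt_integral_of_dominated_loc_of_deriv_le (𝕜 := ℝ)
    (F := fun w p => heatFreq w p * Complex.exp (Complex.I * (p * x : ℝ)))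
    (F' := fun w p => heatFreqDeriv w p * Complex.exp (Complex.I * (p * x : ℝ)))
    (x₀ := v) (s := Set.Ioi (v / 2))
    (bound := fun p => (4 * Real.pi)⁻¹ * (|p| ^ 3 * Real.exp (-(p ^ 2 * (v / 2) / 2))))
    (Ioi_mem_nhds (by linarith)) (Eventually.of_forall hm) ?_ ?_ ?_ ?_ ?_).2
  · exact (Complex.reCLM.hasFDerivAt.comp_hasDerivAt v h)
  · refine (integrable_heatFreq hv).mono (hm v) (ae_of_all _ fun p => ?_)
    rw [norm_mul, norm_exp_I_mul, mul_one]
  · exact ((continuous_heatFreqDeriv.comp (by fun_prop : Continuous fun p => (v, p))).mul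
      (by fun_prop)).aestronglyMeasurable
  · refine ae_of_all _ fun p w hw => ?_
    rw [norm_mul, norm_exp_I_mul, mul_one]
    exact norm_heatFreqDeriv_anti (Set.mem_Ioi.1 hw).le p
  · exact (integrable_abs_pow_mul_exp (by positivity) 3).const_mul _
  · exact ae_of_all _ fun p w _ => (hd w p).mul_const _

theorem heatDeriv_sub {η ε : ℝ} (hη : 0 < η) (h : η ≤ ε) (x : ℝ) :
    heatDeriv ε x - heatDeriv η x = ∫ v in Set.Ioc η ε, heatTimeDeriv v x := by
  rw [← intervalIntegral.integral_of_le h, intervalIntegral.integral_eq_sub_of_hasDerivAt]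
  · intro v hv
    rw [Set.uIcc_of_le h] at hv
    exact hasDerivAt_heatDeriv (hη.trans_le hv.1) x
  · rw [intervalIntegrable_iff_integrableOn_Ioc_of_le h]
    refine (integrable_const (heatTimeBound η)).mono'
      (measurable_heatTimeDeriv.comp measurable_prodMk_right).aestronglyMeasurable ?_
    filter_upwards [ae_restrict_mem measurableSet_Ioc] with v hv
    exact abs_heatTimeDeriv_le hη hv.1.le x

/-! ### The regularisation as a triangle integral, and its limit -/

theorem dsltApprox_eq {Ω : Type*} (B : ℝ≥0 → Ω → ℝ) {ε : ℝ} (hε : 0 < ε) (ω : Ω)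
    (hc : Continuous (B · ω)) : dsltApprox B ε ω = (triangleIntegral B (heatDeriv ε) ω : ℂ) := by
  have hF := isFourier_heatDeriv hε
  have e1 : ∀ t s : ℝ, Complex.I / (2 * (Real.pi : ℂ)) * ∫ p : ℝ, (p : ℂ) * Complex.exp (Complex.I *
      (p : ℂ) * ((B t.toNNReal ω - B s.toNNReal ω : ℝ) : ℂ)) *
        Complex.exp (-((p : ℂ) ^ 2 * (ε : ℂ) / 2)) = (heatDeriv ε (incr B (t, s) ω) : ℂ) := by
    intro t s
    rw [hF.eq, ← integral_const_mul]
    refine integral_congr_ae (ae_of_all _ fun p => ?_)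
    simp only [heatFreq, incr]
    push_cast
    rw [← mul_assoc Complex.I (p : ℂ)]
    ring
  have hmeas : Measurable fun z : ℝ × ℝ => heatDeriv ε (incr B z ω) := by
    refine hF.continuous.measurable.comp ?_
    unfold incr
    have := hc.measurable
    fun_prop
  unfold dsltApprox
  rw [← intervalIntegral.integral_const_mul]
  simp_rw [← intervalIntegral.integral_const_mul, e1, intervalIntegral.integral_ofReal]
  congr 1
  rw [intervalIntegral.integral_of_le zero_le_one]
  have hi : Integrable ((triangle 0 1).indicator fun z => heatDeriv ε (incr B z ω))
      ((volume : Measure ℝ).prod volume) := by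
    rw [← Measure.volume_eq_prod, integrable_indicator_iff (measurableSet_triangle _ _)]
    exact (integrable_const _).mono' hmeas.aestronglyMeasurable (ae_of_all _ fun z => hF.abs_le _)
  unfold triangleIntegral
  rw [← integral_indicator (measurableSet_triangle _ _), Measure.volume_eq_prod,
    integral_prod _ hi, ← integral_indicator measurableSet_Ioc]
  refine integral_congr_ae (ae_of_all _ fun t => ?_)
  simp only
  by_cases ht : t ∈ Set.Ioc (0 : ℝ) 1
  · rw [Set.indicator_of_mem ht, intervalIntegral.integral_of_le ht.1.le,
      ← integral_indicator measurableSet_Ioc]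
    refine integral_congr_ae (ae_of_all _ fun s => ?_)
    simp only [Set.indicator, triangle, Set.mem_Ioc, Set.mem_ofPred_eq]
    have := ht.2
    congr 1
    simp [this]
  · rw [Set.indicator_of_notMem ht]
    symm
    refine integral_eq_zero_of_ae (ae_of_all _ fun s => ?_)
    refine Set.indicator_of_notMem ?_ _
    rintro ⟨h1, h2, h3⟩
    simp only at h1 h2 h3
    exact ht ⟨by linarith, by linarith⟩

section
variable {Ω : Type*} [MeasurableSpace Ω] {P : Measure Ω} {B : ℝ≥0 → Ω → ℝ}

theorem measurable_triangleIntegral_heatTimeDeriv (hB : IsContinuousBrownian B P) :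
    Measurable fun q : ℝ × Ω => triangleIntegral B (heatTimeDeriv q.1) q.2 := by
  have h1 : Measurable fun r : (ℝ × Ω) × (ℝ × ℝ) => heatTimeDeriv r.1.1 (incr B r.2 r.1.2) := by
    have h2 : Measurable fun r : (ℝ × Ω) × (ℝ × ℝ) => (r.2, r.1.2) := by fun_prop
    exact measurable_heatTimeDeriv_comp (measurable_fst.comp measurable_fst)
      (hB.measurable_incr.comp h2)
  exact (h1.stronglyMeasurable.integral_prod_right'
    (ν := volume.restrict (triangle 0 1))).measurable

/-- The fundamental theorem of calculus in the regularisation parameter, followed by Fubini. Staying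
above `η > 0` keeps the time derivative bounded. -/
theorem triangleIntegral_heatDeriv_sub (hB : IsContinuousBrownian B P) {η ε : ℝ} (hη : 0 < η)
    (h : η ≤ ε) (ω : Ω) :
    triangleIntegral B (heatDeriv ε) ω - triangleIntegral B (heatDeriv η) ω =
      ∫ v in Set.Ioc η ε, triangleIntegral B (heatTimeDeriv v) ω := by
  have hm : Measurable fun z => incr B z ω := hB.measurable_incr.comp measurable_prodMk_right
  have hi : ∀ {v}, 0 < v → Integrable (fun z => heatDeriv v (incr B z ω))
      (volume.restrict (triangle 0 1)) := fun hv =>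
    (integrable_const _).mono'
      ((isFourier_heatDeriv hv).continuous.measurable.comp hm).aestronglyMeasurable
      (ae_of_all _ fun z => (isFourier_heatDeriv hv).abs_le _)
  unfold triangleIntegral
  rw [← integral_sub (hi (hη.trans_le h)) (hi hη)]
  simp_rw [heatDeriv_sub hη h]
  rw [integral_integral_swap]
  have hmm : Measurable (Function.uncurry fun (z : ℝ × ℝ) v => heatTimeDeriv v (incr B z ω)) :=
    measurable_heatTimeDeriv_comp measurable_snd (hm.comp measurable_fst)
  refine (integrable_const (heatTimeBound η)).mono' hmm.aestronglyMeasurable ?_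
  have : ∀ᵐ q ∂((volume.restrict (triangle 0 1)).prod (volume.restrict (Set.Ioc η ε))),
      q.2 ∈ Set.Ioc η ε :=
    Measure.quasiMeasurePreserving_snd.ae (ae_restrict_mem measurableSet_Ioc)
  filter_upwards [this] with q hq
  exact abs_heatTimeDeriv_le hη hq.1.le _

theorem lintegral_enorm_triangleIntegral_heatTimeDeriv_le [IsProbabilityMeasure P]
    (hB : IsContinuousBrownian B P) {v : ℝ} (hv : 0 < v) :
    ∫⁻ ω, ‖triangleIntegral B (heatTimeDeriv v) ω‖ₑ ∂P ≤
      ENNReal.ofReal (firstMomentConst * v ^ (-(7 / 8) : ℝ)) := by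
  have hF := isFourier_heatTimeDeriv hv
  have h1 := integral_abs_triangleIntegral_le hB hF (hF.odd (heatFreqDeriv_neg v))
    (by positivity) (norm_heatFreqDeriv_le hv)
  have hi : Integrable (triangleIntegral B (heatTimeDeriv v)) P :=
    (integrable_const _).mono' (measurable_triangleIntegral hB
      hF.continuous.measurable).aestronglyMeasurable
      (ae_of_all _ fun ω => abs_triangleIntegral_le hF.abs_le ω)
  rw [← ofReal_integral_norm_eq_lintegral_enorm hi]
  exact ENNReal.ofReal_le_ofReal h1

theorem lintegral_rpow_Ioc_lt_top :
    ∫⁻ v in Set.Ioc (0 : ℝ) 1, ENNReal.ofReal (firstMomentConst * v ^ (-(7 / 8) : ℝ)) < ∞ := by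
  have h := (intervalIntegral.intervalIntegrable_rpow' (a := 0) (b := 1)
    (by norm_num : (-1 : ℝ) < -(7 / 8))).const_mul firstMomentConst
  rw [intervalIntegrable_iff_integrableOn_Ioc_of_le zero_le_one] at h
  refine lt_of_le_of_lt (lintegral_mono fun v => ?_) h.2
  rw [← ofReal_norm]
  exact ENNReal.ofReal_le_ofReal (le_abs_self _)

theorem tendsto_volume_Ioc_zero :
    Tendsto (fun ε : ℝ => (volume.restrict (Set.Ioc (0 : ℝ) 1)) (Set.Ioc 0 ε)) (𝓝[>] 0) (𝓝 0) := by
  have h1 : Tendsto (fun ε : ℝ => ENNReal.ofReal ε) (𝓝[>] 0) (𝓝 0) := by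
    have := (ENNReal.continuous_ofReal.tendsto 0).mono_left (nhdsWithin_le_nhds (s := Set.Ioi 0))
    simpa using this
  refine tendsto_of_tendsto_of_tendsto_of_le_of_le tendsto_const_nhds h1
    (fun _ => bot_le) fun ε => ?_
  refine (Measure.restrict_le_self _).trans ?_
  simp

/-- The derivative of self-intersection local time, as the value at `ε = 1` corrected by the
integral of the derivative in `ε`. -/
noncomputable def dsltLimit (B : ℝ≥0 → Ω → ℝ) (ω : Ω) : ℝ :=
  triangleIntegral B (heatDeriv 1) ω -
    ∫ v in Set.Ioc (0 : ℝ) 1, triangleIntegral B (heatTimeDeriv v) ω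

theorem measurable_dsltLimit (hB : IsContinuousBrownian B P) : Measurable (dsltLimit B) := by
  have h1 := (measurable_triangleIntegral_heatTimeDeriv hB).comp measurable_swap
  exact (measurable_triangleIntegral hB
    (isFourier_heatDeriv one_pos).continuous.measurable).sub
      (h1.stronglyMeasurable.integral_prod_right'
        (ν := volume.restrict (Set.Ioc (0 : ℝ) 1))).measurable

theorem lintegral_lintegral_heatTimeDeriv_le [IsProbabilityMeasure P]
    (hB : IsContinuousBrownian B P) {ε : ℝ} :
    ∫⁻ ω, (∫⁻ v in Set.Ioc (0 : ℝ) ε, ‖triangleIntegral B (heatTimeDeriv v) ω‖ₑ) ∂P ≤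
      ∫⁻ v in Set.Ioc (0 : ℝ) ε, ENNReal.ofReal (firstMomentConst * v ^ (-(7 / 8) : ℝ)) := by
  have hm : Measurable (Function.uncurry fun (ω : Ω) (v : ℝ) =>
      ‖triangleIntegral B (heatTimeDeriv v) ω‖ₑ) :=
    ((measurable_triangleIntegral_heatTimeDeriv hB).comp measurable_swap).enorm
  rw [lintegral_lintegral_swap hm.aemeasurable]
  refine lintegral_mono_ae ?_
  filter_upwards [ae_restrict_mem measurableSet_Ioc] with v hv
  exact lintegral_enorm_triangleIntegral_heatTimeDeriv_le hB hv.1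

theorem ae_integrableOn_heatTimeDeriv [IsProbabilityMeasure P] (hB : IsContinuousBrownian B P) :
    ∀ᵐ ω ∂P, IntegrableOn (fun v => triangleIntegral B (heatTimeDeriv v) ω)
      (Set.Ioc (0 : ℝ) 1) := by
  have hm := (measurable_triangleIntegral_heatTimeDeriv hB).comp measurable_swap
  have h1 : AEMeasurable (fun ω => ∫⁻ v in Set.Ioc (0 : ℝ) 1,
      ‖triangleIntegral B (heatTimeDeriv v) ω‖ₑ) P :=
    (Measurable.lintegral_prod_right' (f := fun q : Ω × ℝ =>
      ‖triangleIntegral B (heatTimeDeriv q.2) q.1‖ₑ) hm.enorm).aemeasurable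
  filter_upwards [ae_lt_top' h1 ((lintegral_lintegral_heatTimeDeriv_le hB).trans_lt
    lintegral_rpow_Ioc_lt_top).ne] with ω hω
  exact ⟨((measurable_triangleIntegral_heatTimeDeriv hB).comp
    measurable_prodMk_right).aestronglyMeasurable, hω⟩

theorem triangleIntegral_sub_dsltLimit (hB : IsContinuousBrownian B P) {ω : Ω}
    (hω : IntegrableOn (fun v => triangleIntegral B (heatTimeDeriv v) ω) (Set.Ioc (0 : ℝ) 1))
    {ε : ℝ} (h0 : 0 < ε) (h1 : ε ≤ 1) :
    triangleIntegral B (heatDeriv ε) ω - dsltLimit B ω =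
      ∫ v in Set.Ioc 0 ε, triangleIntegral B (heatTimeDeriv v) ω := by
  have e := triangleIntegral_heatDeriv_sub hB h0 h1 ω
  have hu : Set.Ioc (0 : ℝ) 1 = Set.Ioc 0 ε ∪ Set.Ioc ε 1 :=
    (Set.Ioc_union_Ioc_eq_Ioc h0.le h1).symm
  have e2 : ∫ v in Set.Ioc (0 : ℝ) 1, triangleIntegral B (heatTimeDeriv v) ω =
      (∫ v in Set.Ioc 0 ε, triangleIntegral B (heatTimeDeriv v) ω) +
        ∫ v in Set.Ioc ε 1, triangleIntegral B (heatTimeDeriv v) ω := by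
    conv_lhs => rw [hu]
    exact setIntegral_union (Set.Ioc_disjoint_Ioc_of_le le_rfl) measurableSet_Ioc
      (hω.mono_set (Set.Ioc_subset_Ioc_right h1)) (hω.mono_set (Set.Ioc_subset_Ioc_left h0.le))
  unfold dsltLimit
  linarith

theorem eventually_Ioc_one : ∀ᶠ ε : ℝ in 𝓝[>] 0, 0 < ε ∧ ε ≤ 1 := by
  filter_upwards [Ioc_mem_nhdsGT (zero_lt_one' ℝ)] with ε hε using hε

theorem restrict_restrict_Ioc {ε : ℝ} (h1 : ε ≤ 1) :
    ((volume : Measure ℝ).restrict (Set.Ioc 0 1)).restrict (Set.Ioc 0 ε) =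
      volume.restrict (Set.Ioc 0 ε) := by
  rw [Measure.restrict_restrict measurableSet_Ioc,
    Set.inter_eq_left.2 (Set.Ioc_subset_Ioc_right h1)]

/-- The error is the integral over `(0, ε]` of a function integrable for almost every `ω`. The
exceptional set does not depend on `ε`, so the limit is along the full continuous parameter. -/
theorem ae_tendsto_dsltLimit [IsProbabilityMeasure P] (hB : IsContinuousBrownian B P) :
    ∀ᵐ ω ∂P, Tendsto (fun ε => triangleIntegral B (heatDeriv ε) ω) (𝓝[>] 0)
      (𝓝 (dsltLimit B ω)) := by
  filter_upwards [ae_integrableOn_heatTimeDeriv hB] with ω hω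
  rw [← tendsto_sub_nhds_zero_iff]
  have h := hω.2.tendsto_setIntegral_nhds_zero tendsto_volume_Ioc_zero
  refine h.congr' ?_
  filter_upwards [eventually_Ioc_one] with ε hε
  rw [triangleIntegral_sub_dsltLimit hB hω hε.1 hε.2, restrict_restrict_Ioc hε.2]

theorem tendsto_lintegral_sub_dsltLimit [IsProbabilityMeasure P] (hB : IsContinuousBrownian B P) :
    Tendsto (fun ε => ∫⁻ ω, ‖triangleIntegral B (heatDeriv ε) ω - dsltLimit B ω‖ₑ ∂P) (𝓝[>] 0)
      (𝓝 0) := by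
  have h := tendsto_setLIntegral_zero lintegral_rpow_Ioc_lt_top.ne tendsto_volume_Ioc_zero
  refine tendsto_of_tendsto_of_tendsto_of_le_of_le' tendsto_const_nhds h
    (Eventually.of_forall fun _ => bot_le) ?_
  filter_upwards [eventually_Ioc_one] with ε hε
  rw [restrict_restrict_Ioc hε.2]
  refine le_trans (lintegral_mono_ae ?_) (lintegral_lintegral_heatTimeDeriv_le hB)
  filter_upwards [ae_integrableOn_heatTimeDeriv hB] with ω hω
  rw [triangleIntegral_sub_dsltLimit hB hω hε.1 hε.2]
  exact enorm_integral_le_lintegral_enorm _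

/-! ### Exponential integrability of the limit -/

/-- An exponent for which the regularisations are uniformly exponentially integrable. -/
noncomputable def expRate : ℝ := (4 * (expConst + 1))⁻¹

theorem expConst_nonneg : 0 ≤ expConst := by
  have := momentConst_nonneg 1
  unfold expConst; positivity

theorem expRate_pos : 0 < expRate := by
  have := expConst_nonneg
  unfold expRate; positivity

theorem lintegral_exp_abs_triangleIntegral_le [IsProbabilityMeasure P]
    (hB : IsContinuousBrownian B P) {ε : ℝ} (hε : 0 < ε) :
    ∫⁻ ω, ENNReal.ofReal (Real.exp (expRate * |triangleIntegral B (heatDeriv ε) ω|)) ∂P ≤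
      2 * ENNReal.ofReal (Real.exp (1 / 2)) := by
  have hF := isFourier_heatDeriv hε
  have hm := measurable_triangleIntegral hB hF.continuous.measurable
  have key : ∀ c : ℝ, |c| = expRate →
      ∫⁻ ω, ENNReal.ofReal (Real.exp (c * triangleIntegral B (heatDeriv ε) ω)) ∂P ≤
        ENNReal.ofReal (Real.exp (1 / 2)) := by
    intro c hc
    have hi : Integrable (fun ω => Real.exp (c * triangleIntegral B (heatDeriv ε) ω)) P := by
      refine (integrable_const (Real.exp (|c| * ∫ p, ‖heatFreq ε p‖))).mono'
        (by fun_prop : Measurable _).aestronglyMeasurable (ae_of_all _ fun ω => ?_)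
      rw [Real.norm_of_nonneg (Real.exp_pos _).le, Real.exp_le_exp]
      refine (le_abs_self _).trans ?_
      rw [abs_mul]
      exact mul_le_mul_of_nonneg_left (abs_triangleIntegral_le hF.abs_le ω) (abs_nonneg _)
    rw [← ofReal_integral_eq_lintegral_ofReal hi (ae_of_all _ fun _ => (Real.exp_pos _).le)]
    refine ENNReal.ofReal_le_ofReal (integral_exp_triangleIntegral_le hB hF
      (hF.odd (heatFreq_neg ε)) zero_le_one (norm_heatFreq_le hε) ?_)
    have := expConst_nonneg
    -- The condition reads `expConst / (expConst + 1) ≤ 1`; the added `1` spares a proof that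
    -- `expConst` is nonzero.
    rw [hc, expRate, one_mul]
    field_simp
    linarith
  rw [two_mul]
  refine le_trans ?_ (add_le_add (key expRate (abs_of_pos expRate_pos))
    (key (-expRate) (by rw [abs_neg, abs_of_pos expRate_pos])))
  rw [← lintegral_add_left (by fun_prop)]
  refine lintegral_mono fun ω => ?_
  rcases abs_choice (triangleIntegral B (heatDeriv ε) ω) with h | h
  · rw [h]; exact le_self_add
  · rw [h, mul_neg, ← neg_mul]; exact le_add_self

/-- Fatou along the sequence `1 / (n + 1)`. -/
theorem lintegral_exp_abs_dsltLimit_le [IsProbabilityMeasure P] (hB : IsContinuousBrownian B P) :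
    ∫⁻ ω, ENNReal.ofReal (Real.exp (expRate * |dsltLimit B ω|)) ∂P ≤
      2 * ENNReal.ofReal (Real.exp (1 / 2)) := by
  let e : ℕ → ℝ := fun n => 1 / ((n : ℝ) + 1)
  have he0 : ∀ n, 0 < e n := fun n => Nat.one_div_pos_of_nat
  have he : Tendsto e atTop (𝓝[>] 0) :=
    tendsto_nhdsWithin_iff.2 ⟨tendsto_one_div_add_atTop_nhds_zero_nat, Eventually.of_forall he0⟩
  have hm : ∀ n, Measurable fun ω =>
      ENNReal.ofReal (Real.exp (expRate * |triangleIntegral B (heatDeriv (e n)) ω|)) := fun n => by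
    have := measurable_triangleIntegral hB (isFourier_heatDeriv (he0 n)).continuous.measurable
    fun_prop
  calc _ = ∫⁻ ω, liminf (fun n => ENNReal.ofReal
        (Real.exp (expRate * |triangleIntegral B (heatDeriv (e n)) ω|))) atTop ∂P := by
        refine lintegral_congr_ae ?_
        filter_upwards [ae_tendsto_dsltLimit hB] with ω hω
        have hc : Continuous fun x : ℝ => ENNReal.ofReal (Real.exp (expRate * |x|)) :=
          ENNReal.continuous_ofReal.comp (by fun_prop)
        exact (((hc.tendsto _).comp (hω.comp he)).liminf_eq).symm
    _ ≤ liminf (fun n => ∫⁻ ω, ENNReal.ofReal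
        (Real.exp (expRate * |triangleIntegral B (heatDeriv (e n)) ω|)) ∂P) atTop :=
        lintegral_liminf_le hm
    _ ≤ _ := by
        refine (liminf_le_liminf (Eventually.of_forall fun n =>
          lintegral_exp_abs_triangleIntegral_le hB (he0 n))).trans (le_of_eq ?_)
        exact liminf_const _

end

/-! ### Convergence in every `L^p` -/

theorem rpow_moment_le {c x y : ℝ} (hc : 0 < c) (m : ℕ) :
    |x - y| ^ m ≤ m.factorial / (c / 2) ^ m * (Real.exp (c * |x|) + Real.exp (c * |y|)) := by
  have h1 := Real.pow_div_factorial_le_exp (c / 2 * |x - y|) (by positivity) m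
  rw [div_le_iff₀ (by positivity), mul_pow] at h1
  have h2 : Real.exp (c / 2 * |x - y|) ≤ Real.exp (c * |x|) + Real.exp (c * |y|) := by
    have h3 : |x - y| ≤ |x| + |y| := abs_sub _ _
    rcases le_total |x| |y| with h | h
    · refine (Real.exp_le_exp.2 ?_).trans (le_add_of_nonneg_left (Real.exp_pos _).le)
      nlinarith
    · refine (Real.exp_le_exp.2 ?_).trans (le_add_of_nonneg_right (Real.exp_pos _).le)
      nlinarith
  rw [div_mul_eq_mul_div, le_div_iff₀ (by positivity)]
  have := mul_le_mul_of_nonneg_left h2 (Nat.cast_nonneg (α := ℝ) m.factorial)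
  linarith

section
variable {Ω : Type*} [MeasurableSpace Ω] {P : Measure Ω} {B : ℝ≥0 → Ω → ℝ}

/-- Cauchy–Schwarz for `|Y|^(n+1) = |Y|^(1/2) * |Y|^(n+1/2)`: convergence in `L¹` together with
bounded higher moments gives convergence of all moments. -/
theorem lintegral_enorm_pow_le {Y : Ω → ℝ} (hY : Measurable Y) (n : ℕ) :
    ∫⁻ ω, ‖Y ω‖ₑ ^ (n + 1) ∂P ≤
      (∫⁻ ω, ‖Y ω‖ₑ ∂P) ^ (1 / 2 : ℝ) * (∫⁻ ω, ‖Y ω‖ₑ ^ (2 * n + 1) ∂P) ^ (1 / 2 : ℝ) := by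
  have h := ENNReal.lintegral_mul_le_Lp_mul_Lq P Real.HolderConjugate.two_two
    (f := fun ω => ‖Y ω‖ₑ ^ (1 / 2 : ℝ)) (g := fun ω => (‖Y ω‖ₑ ^ (2 * n + 1)) ^ (1 / 2 : ℝ))
    (by fun_prop) (by fun_prop)
  have e : ∀ a : ℝ≥0∞, (a ^ (1 / 2 : ℝ)) ^ (2 : ℝ) = a := fun a => by
    rw [← ENNReal.rpow_mul]; norm_num
  simp only [Pi.mul_apply, e] at h
  refine le_trans (le_of_eq (lintegral_congr fun ω => ?_)) h
  rw [← ENNReal.rpow_natCast, ← ENNReal.rpow_natCast, ← ENNReal.rpow_mul,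
    ← ENNReal.rpow_add_of_nonneg _ _ (by positivity) (by positivity)]
  congr 1
  push_cast; ring

theorem tendsto_lintegral_pow_sub_dsltLimit [IsProbabilityMeasure P]
    (hB : IsContinuousBrownian B P) (n : ℕ) :
    Tendsto (fun ε => ∫⁻ ω, ‖triangleIntegral B (heatDeriv ε) ω - dsltLimit B ω‖ₑ ^ (n + 1) ∂P)
      (𝓝[>] 0) (𝓝 0) := by
  set m := 2 * n + 1
  set A : ℝ≥0∞ := ENNReal.ofReal (m.factorial / (expRate / 2) ^ m) *
    (2 * ENNReal.ofReal (Real.exp (1 / 2)) + 2 * ENNReal.ofReal (Real.exp (1 / 2)))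
  have hA : A ≠ ∞ := by finiteness
  have hc := expRate_pos
  have h1 := ENNReal.Tendsto.mul_const (b := A ^ (1 / 2 : ℝ))
    ((tendsto_lintegral_sub_dsltLimit hB).ennrpow_const (1 / 2)) (Or.inr (by finiteness))
  rw [ENNReal.zero_rpow_of_pos (by norm_num), zero_mul] at h1
  refine tendsto_of_tendsto_of_tendsto_of_le_of_le' tendsto_const_nhds h1
    (Eventually.of_forall fun _ => bot_le) ?_
  filter_upwards [self_mem_nhdsWithin] with ε hε
  have hθ := measurable_triangleIntegral hB (isFourier_heatDeriv hε).continuous.measurable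
  have hm := measurable_dsltLimit hB
  refine (lintegral_enorm_pow_le (hθ.sub hm) n).trans ?_
  refine mul_le_mul' le_rfl (ENNReal.rpow_le_rpow ?_ (by norm_num))
  refine le_trans ?_ (mul_le_mul' le_rfl (add_le_add (lintegral_exp_abs_triangleIntegral_le hB hε)
    (lintegral_exp_abs_dsltLimit_le hB)))
  rw [← lintegral_add_left (by fun_prop), ← lintegral_const_mul' _ _ ENNReal.ofReal_ne_top]
  refine lintegral_mono fun ω => ?_
  simp only [Pi.sub_apply]
  rw [← ofReal_norm, ← ENNReal.ofReal_pow (norm_nonneg _),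
    ← ENNReal.ofReal_add (Real.exp_pos _).le (Real.exp_pos _).le,
    ← ENNReal.ofReal_mul (by positivity), Real.norm_eq_abs]
  -- The exponential moments at rate `expRate`, of the regularisation and of the limit, control the
  -- moment of order `m` of their difference uniformly in `ε`.
  exact ENNReal.ofReal_le_ofReal (rpow_moment_le hc m)

theorem tendsto_eLpNorm_sub_dsltLimit [IsProbabilityMeasure P]
    (hB : IsContinuousBrownian B P) {p : ℝ≥0∞} (hp : p ≠ ∞) :
    Tendsto (fun ε => eLpNorm (fun ω => triangleIntegral B (heatDeriv ε) ω - dsltLimit B ω) p P)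
      (𝓝[>] 0) (𝓝 0) := by
  obtain ⟨n, hn⟩ := ENNReal.exists_nat_gt hp
  have h1 := (tendsto_lintegral_pow_sub_dsltLimit hB n).ennrpow_const (1 / ((n + 1 : ℕ) : ℝ))
  rw [ENNReal.zero_rpow_of_pos (by positivity)] at h1
  refine tendsto_of_tendsto_of_tendsto_of_le_of_le' tendsto_const_nhds h1
    (Eventually.of_forall fun _ => bot_le) ?_
  filter_upwards [self_mem_nhdsWithin] with ε hε
  have hθ := measurable_triangleIntegral hB (isFourier_heatDeriv hε).continuous.measurable
  have hpn : p ≤ ((n + 1 : ℕ) : ℝ≥0∞) := hn.le.trans (by exact_mod_cast Nat.le_succ n)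
  refine (eLpNorm_le_eLpNorm_of_exponent_le hpn
    (hθ.sub (measurable_dsltLimit hB)).aestronglyMeasurable).trans (le_of_eq ?_)
  rw [eLpNorm_eq_lintegral_rpow_enorm_toReal (by simp) (by simp)]
  simp only [ENNReal.toReal_natCast, ENNReal.rpow_natCast, Pi.sub_apply]

/-! ### Regular version, scaling and conclusion -/

/-- Set the process to zero on a measurable null set outside which paths are continuous and agree
with measurable modifications at a countable dense set of times. Measurability at the other times
follows by limits along that set. -/
theorem exists_isContinuousBrownian (hB : IsBrownianReal B P) :
    ∃ B' : ℝ≥0 → Ω → ℝ, IsContinuousBrownian B' P ∧ ∀ᵐ ω ∂P, ∀ t, B t ω = B' t ω := by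
  obtain ⟨D, hDc, hD⟩ := TopologicalSpace.exists_countable_dense ℝ≥0
  have hgood : ∀ᵐ ω ∂P, Continuous (B · ω) ∧
      ∀ q ∈ D, B q ω = (hB.aemeasurable q).mk (B q) ω := by
    filter_upwards [hB.cont, (ae_ball_iff hDc).2 fun q _ => (hB.aemeasurable q).ae_eq_mk]
      with ω h1 h2 using ⟨h1, h2⟩
  obtain ⟨G, hGsub, hGm, hG0⟩ := exists_measurable_superset_of_null (ae_iff.1 hgood)
  have hGood : ∀ ω ∉ G, Continuous (B · ω) ∧
      ∀ q ∈ D, B q ω = (hB.aemeasurable q).mk (B q) ω := fun ω hω => by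
    by_contra hcon
    exact hω (hGsub hcon)
  let B' : ℝ≥0 → Ω → ℝ := fun t => Gᶜ.indicator (B t)
  have hae : ∀ᵐ ω ∂P, ∀ t, B t ω = B' t ω := by
    have : ∀ᵐ ω ∂P, ω ∉ G := measure_eq_zero_iff_ae_notMem.1 hG0
    filter_upwards [this] with ω hω t
    exact (Set.indicator_of_mem (s := Gᶜ) hω (B t)).symm
  have hc : ∀ ω, Continuous (B' · ω) := by
    intro ω
    by_cases hω : ω ∈ G
    · have : (B' · ω) = fun _ => 0 := by
        funext t; exact Set.indicator_of_notMem (by simpa using hω) _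
      rw [this]; exact continuous_const
    · have : (B' · ω) = (B · ω) := by
        funext t; exact Set.indicator_of_mem (s := Gᶜ) hω _
      rw [this]; exact (hGood ω hω).1
  have hmD : ∀ q ∈ D, Measurable (B' q) := by
    intro q hq
    have : B' q = Gᶜ.indicator ((hB.aemeasurable q).mk (B q)) :=
      Set.indicator_congr fun ω hω => (hGood ω hω).2 q hq
    rw [this]
    exact (hB.aemeasurable q).measurable_mk.indicator hGm.compl
  refine ⟨B', ⟨hB.toIsPreBrownianReal.congr fun t => hae.mono fun ω h => h t, fun t => ?_, hc⟩, hae⟩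
  obtain ⟨u, huD, hu⟩ := mem_closure_iff_seq_limit.1 (hD t)
  exact measurable_of_tendsto_metrizable (fun n => hmD _ (huD n))
    (tendsto_pi_nhds.2 fun ω => ((hc ω).tendsto t).comp hu)

end

/-- Substitute `p ↦ σ * p`: one factor `σ⁻¹` comes from the Jacobian and one from the factor `p` of
the integrand. -/
theorem dsltApprox_const_mul {Ω : Type*} {B X : ℝ≥0 → Ω → ℝ} {σ : ℝ} (hσ : 0 < σ)
    (hX : ∀ t ω, X t ω = σ * B t ω) (ε : ℝ) (ω : Ω) :
    dsltApprox X ε ω = ((σ ^ 2)⁻¹ : ℝ) * dsltApprox B (ε / σ ^ 2) ω := by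
  have hσ' : (σ : ℂ) ≠ 0 := by exact_mod_cast hσ.ne'
  have key : ∀ x : ℝ, ∫ p : ℝ, (p : ℂ) * Complex.exp (Complex.I * (p : ℂ) * ((σ * x : ℝ) : ℂ)) *
        Complex.exp (-((p : ℂ) ^ 2 * (ε : ℂ) / 2)) =
      ((σ ^ 2)⁻¹ : ℝ) * ∫ p : ℝ, (p : ℂ) * Complex.exp (Complex.I * (p : ℂ) * (x : ℂ)) *
        Complex.exp (-((p : ℂ) ^ 2 * ((ε / σ ^ 2 : ℝ) : ℂ) / 2)) := by
    intro x
    have h := Measure.integral_comp_mul_left (fun p : ℝ =>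
      (p : ℂ) * Complex.exp (Complex.I * (p : ℂ) * (x : ℂ)) *
        Complex.exp (-((p : ℂ) ^ 2 * ((ε / σ ^ 2 : ℝ) : ℂ) / 2))) σ
    rw [abs_of_pos (inv_pos.2 hσ), Complex.real_smul] at h
    have e : ∀ p : ℝ, (p : ℂ) * Complex.exp (Complex.I * (p : ℂ) * ((σ * x : ℝ) : ℂ)) *
        Complex.exp (-((p : ℂ) ^ 2 * (ε : ℂ) / 2)) = (σ : ℂ)⁻¹ *
        (((σ * p : ℝ) : ℂ) * Complex.exp (Complex.I * ((σ * p : ℝ) : ℂ) * (x : ℂ)) *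
          Complex.exp (-(((σ * p : ℝ) : ℂ) ^ 2 * ((ε / σ ^ 2 : ℝ) : ℂ) / 2))) := by
      intro p
      have e1 : Complex.I * (p : ℂ) * ((σ * x : ℝ) : ℂ) =
          Complex.I * ((σ * p : ℝ) : ℂ) * (x : ℂ) := by push_cast; ring
      have e2 : -((p : ℂ) ^ 2 * (ε : ℂ) / 2) =
          -(((σ * p : ℝ) : ℂ) ^ 2 * ((ε / σ ^ 2 : ℝ) : ℂ) / 2) := by
        push_cast; field_simp
      rw [e1, e2]
      push_cast
      field_simp
    simp_rw [e]
    rw [integral_const_mul, h, ← mul_assoc]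
    congr 1
    push_cast
    field_simp
  unfold dsltApprox
  simp_rw [hX, ← mul_sub, key, intervalIntegral.integral_const_mul]
  ring

theorem corollary3p2 {Ω : Type*} [MeasurableSpace Ω] (P : Measure Ω) [IsProbabilityMeasure P]
    (B : ℝ≥0 → Ω → ℝ) (hB : IsBrownianReal B P) (σ : ℝ) (hσ : 0 < σ)
    (X : ℝ≥0 → Ω → ℝ) (hX : ∀ t ω, X t ω = σ * B t ω) :
    (∀ᵐ ω ∂P, Tendsto (fun ε : ℝ => dsltApprox X ε ω) (𝓝[>] 0) (𝓝 (dslt X ω))) ∧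
    (∀ p : ℝ≥0∞, p ≠ 0 → p ≠ ∞ →
      Tendsto (fun ε : ℝ => eLpNorm (fun ω => dsltApprox X ε ω - dslt X ω) p P)
        (𝓝[>] 0) (𝓝 0)) ∧
    ∀ γ : ℝ, 0 ≤ γ → γ < 1 / 2 →
      ∃ M : ℝ, 0 < M ∧ Integrable (fun ω => Real.exp (M * ‖dslt X ω‖ ^ γ)) P := by
  obtain ⟨B', hB', hBB'⟩ := exists_isContinuousBrownian hB
  have hs : 0 < σ ^ 2 := by positivity
  have happrox : ∀ᵐ ω ∂P, ∀ ε : ℝ, 0 < ε → dsltApprox X ε ω =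
      ((σ ^ 2)⁻¹ : ℝ) * (triangleIntegral B' (heatDeriv (ε / σ ^ 2)) ω : ℂ) := by
    filter_upwards [hBB'] with ω hω ε hε
    have : dsltApprox B (ε / σ ^ 2) ω = dsltApprox B' (ε / σ ^ 2) ω := by
      unfold dsltApprox; simp_rw [hω]
    rw [dsltApprox_const_mul hσ hX, this, dsltApprox_eq B' (by positivity) ω (hB'.cont ω)]
  have hscale : Tendsto (fun ε : ℝ => ε / σ ^ 2) (𝓝[>] 0) (𝓝[>] 0) := by
    refine tendsto_nhdsWithin_iff.2 ⟨?_, ?_⟩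
    · have : Tendsto (fun ε : ℝ => ε / σ ^ 2) (𝓝 0) (𝓝 (0 / σ ^ 2)) :=
        tendsto_id.div_const _
      rw [zero_div] at this
      exact this.mono_left nhdsWithin_le_nhds
    · filter_upwards [self_mem_nhdsWithin] with ε hε
      exact div_pos hε hs
  have hlim : ∀ᵐ ω ∂P, Tendsto (fun ε : ℝ => dsltApprox X ε ω) (𝓝[>] 0)
      (𝓝 (((σ ^ 2)⁻¹ : ℝ) * (dsltLimit B' ω : ℂ))) := by
    filter_upwards [happrox, ae_tendsto_dsltLimit hB'] with ω h1 h2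
    have h3 := ((Complex.continuous_ofReal.tendsto _).comp (h2.comp hscale)).const_mul
      (((σ ^ 2)⁻¹ : ℝ) : ℂ)
    refine h3.congr' ?_
    filter_upwards [self_mem_nhdsWithin] with ε hε
    exact (h1 ε hε).symm
  have hdslt : ∀ᵐ ω ∂P, dslt X ω = ((σ ^ 2)⁻¹ : ℝ) * (dsltLimit B' ω : ℂ) :=
    hlim.mono fun ω h => h.limUnder_eq
  refine ⟨?_, fun p _ hp => ?_, fun γ h0 hγ => ?_⟩
  · filter_upwards [hlim, hdslt] with ω h1 h2
    rw [h2]; exact h1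
  · have h1 := ENNReal.Tendsto.const_mul (a := ‖(σ ^ 2)⁻¹‖ₑ)
      ((tendsto_eLpNorm_sub_dsltLimit hB' hp).comp hscale) (Or.inr (by finiteness))
    rw [mul_zero] at h1
    refine h1.congr' ?_
    filter_upwards [self_mem_nhdsWithin] with ε hε
    rw [Function.comp_apply, ← eLpNorm_const_smul]
    refine eLpNorm_congr_norm_ae ?_
    filter_upwards [happrox, hdslt] with ω h2 h3
    rw [h2 ε hε, h3, ← mul_sub, ← Complex.ofReal_sub, ← Complex.ofReal_mul, Complex.norm_real]
    rfl
  · have hc := expRate_pos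
    have hm := measurable_dsltLimit hB'
    -- The factor `σ ^ 2` undoes the scaling of the limit. As `x ^ γ ≤ 1 + x` for `0 ≤ γ ≤ 1`, the
    -- exponential moment of order one suffices, with the constant `exp (expRate * σ ^ 2)` in front.
    refine ⟨expRate * σ ^ 2, by positivity, ?_⟩
    have hi : Integrable (fun ω => Real.exp (expRate * |dsltLimit B' ω|)) P := by
      refine ⟨(by fun_prop : Measurable _).aestronglyMeasurable, ?_⟩
      refine lt_of_le_of_lt (le_of_eq (lintegral_congr fun ω => ?_))
        ((lintegral_exp_abs_dsltLimit_le hB').trans_lt (by finiteness))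
      rw [← ofReal_norm, Real.norm_of_nonneg (Real.exp_pos _).le]
    refine (hi.const_mul (Real.exp (expRate * σ ^ 2))).mono' ?_ ?_
    · have : AEMeasurable (dslt X) P := by
        refine AEMeasurable.congr (f := fun ω => ((σ ^ 2)⁻¹ : ℝ) * (dsltLimit B' ω : ℂ)) ?_
          (hdslt.mono fun ω h => h.symm)
        fun_prop
      exact AEMeasurable.aestronglyMeasurable (by fun_prop)
    · filter_upwards [hdslt] with ω h
      have hn : ‖dslt X ω‖ = (σ ^ 2)⁻¹ * |dsltLimit B' ω| := by
        rw [h, ← Complex.ofReal_mul, Complex.norm_real, norm_mul, Real.norm_eq_abs,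
          Real.norm_eq_abs, abs_of_pos (inv_pos.2 hs)]
      have hle : ‖dslt X ω‖ ^ γ ≤ 1 + ‖dslt X ω‖ := by
        rcases le_total ‖dslt X ω‖ 1 with h' | h'
        · exact (Real.rpow_le_one (norm_nonneg _) h' h0).trans
            (le_add_of_nonneg_right (norm_nonneg _))
        · refine (Real.rpow_le_rpow_of_exponent_le h' (by linarith : γ ≤ 1)).trans ?_
          rw [Real.rpow_one]; linarith
      rw [Real.norm_of_nonneg (Real.exp_pos _).le, ← Real.exp_add, Real.exp_le_exp]
      refine (mul_le_mul_of_nonneg_left hle (by positivity)).trans (le_of_eq ?_)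
      rw [hn]
      field_simp
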